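/- **Conventions.** Random variables (r.v.'s) are real, and identically distributed r.v.'s are identified. For an r.v. $X$ with distribution function $F$, let $F^{-1}(u)=\inf\{x:F(x)\ge u\}$, $0<u<1$, be its left-continuous inverse, and let $L(u)=-\log(1-u)$, $0<u<1$. Let $U_1<U_2<\cdots$ be the sequence of (upper) record values of an i.i.d. sequence of standard uniform r.v.'s. The records of $X$ are $R_n=F^{-1}(U_n)$, $n\ge1$; if $\mathbb E|R_n|<\infty$ for all $n\ge 1$, then $(\rho_n)_{n\ge1}$ with $\rho_n=\mathbb E R_n$ is the expected record sequence of $X$. **Spaces.** $\mathcal H^*$ is the set of non-constant, non-decreasing, left-continuous functions $H:(0,\infty)\to\mathbb R$ with $\int_0^\infty y^m e^{-y}|H(y)|\,dy<\infty$ for $m=0,1,2,\dots$, and $\mathcal H_0$ is the set of $H\in\mathcal H^*$ with $\int_0^\infty e^{-y}H(y)\,dy=0$ and $\int_0^\infty y e^{-y}H(y)\,dy=1$. An r.v. $X$ belongs to $\mathcal H^*$ (respectively $\mathcal H_0$) if $F^{-1}(u)=H(-\log(1-u))$, $0<u<1$, for some $H\in\mathcal H^*$ (respectively $H\in\mathcal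 H_0$). $\mathcal T$ is the set of r.v.'s $T$ with $\Pr(T>0)=1$ and finite moments of every order. **Mappings.** For $X\in\mathcal H^*$ with distribution function $F$, $\varphi(X)=L(F(V))$, where $V$ has Lebesgue density $$f_V(x)=\frac{(1-F(x))L(F(x))}{\int_{\mathbb R}(1-F(y))L(F(y))\,dy},\qquad x\in\mathbb R,$$ and $(1-F(x))L(F(x))$ is read as $0$ if $F(x)\in\{0,1\}$. For $T\in\mathcal T$ with distribution function $F_T$, $\varphi'(T)$ is the r.v. whose inverse distribution function is $G_0(u)=H_0(-\log(1-u))$, $0<u<1$, where $$H_0(y)=\frac{e^y}{y}F_T(y-)-\int_1^y\frac{x-1}{x^2}e^xF_T(x)\,dx-c_T,\qquad y>0,$$ $F_T(y-)=\Pr(T<y)$, and $c_T$ is the unique constant for which $\int_0^\infty e^{-y}H_0(y)\,dy=0$. **Moment relation.** A sequence $(\rho_n)_{n\ge1}$ and an r.v. $T\in\mathcal T$ satisfy $(6)$ if $$\frac{\rho_{n+2}-\rho_{n+1}}{\rho_2-\rho_1}=\frac{\mathbb E T^n}{(n+1)!},\qquad n=0,1,2,\dots.\tag{6}$$ **Theorem.**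 (i) Every $X\in\mathcal H^*$ has an expected record sequence $(\rho_n)_{n\ge1}$; moreover $T=\varphi(X)$ belongs to $\mathcal T$, and $(\rho_n)_{n\ge 1}$ and $T$ satisfy $(6)$. (ii) For every $T\in\mathcal T$, the r.v. $X_0=\varphi'(T)$ is well defined (there is an r.v. with inverse distribution function $G_0$) and belongs to $\mathcal H_0$, and it has an expected record sequence $(\rho_n)_{n\ge1}$ with $\rho_1=0$, $\rho_2=1$, and $(\rho_n)_{n\ge 1}$ and $T$ satisfy $(6)$. -/

import Mathlib

open MeasureTheory ProbabilityTheory Set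

namespace RecordSeq

noncomputable section

/-! Identically distributed random variables are identified, so a real random variable enters
through its law, a probability measure on `ℝ`. -/

/-- `L(u) = -log(1-u)`. Lean's conventions give `L 0 = L 1 = 0`, so that `(1-u) L(u)` is `0`
for `u = 0` and for `u = 1`. -/
def L (u : ℝ) : ℝ := -Real.log (1 - u)

/-- The left-continuous inverse distribution function `F⁻¹(u) = inf {x : F(x) ≥ u}`,
`0 < u < 1`, where `F` is the distribution function of `μ`. -/
def quantile (μ : Measure ℝ) (u : ℝ) : ℝ := sInf {x : ℝ | u ≤ cdf μ x}

/-! ### Records -/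

/-- Record times of a sequence `x 0, x 1, …`. Terms and records are numbered from `0`: the first
record time is `0`, and the next record time after `t` is `inf {m > t : x m > x t}`. -/
def recordTime (x : ℕ → ℝ) : ℕ → ℕ
  | 0 => 0
  | n + 1 => sInf {m : ℕ | recordTime x n < m ∧ x (recordTime x n) < x m}

/-- The `(n+1)`-st (upper) record value of the sequence `x`. -/
def recordValue (x : ℕ → ℝ) (n : ℕ) : ℝ := x (recordTime x n)

/-- `ξ 0, ξ 1, …` are i.i.d. random variables with the standard uniform distribution. -/
structure IsUniformSample {Ω : Type*} [MeasurableSpace Ω] (P : Measure Ω)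
    (ξ : ℕ → Ω → ℝ) : Prop where
  measurable : ∀ i, Measurable (ξ i)
  indep : iIndepFun ξ P
  uniform : ∀ i, pdf.IsUniform (ξ i) (Ioo 0 1) P volume

/-- The record process of `μ`: its `(n+1)`-st term is `R_{n+1} = F⁻¹(U_{n+1})`, where
`U_1 < U_2 < ⋯` is the record process of the uniform sample `ξ`. -/
def record {Ω : Type*} (ξ : ℕ → Ω → ℝ) (μ : Measure ℝ) (n : ℕ) (ω : Ω) : ℝ :=
  quantile μ (recordValue (fun i => ξ i ω) n)

/-- `(ρ 1, ρ 2, …)` is the expected record sequence of `μ`: every record value is integrable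
and `ρ n = E R_n` for all `n ≥ 1` (the value `ρ 0` plays no role). -/
def IsExpectedRecordSequence {Ω : Type*} [MeasurableSpace Ω] (P : Measure Ω)
    (ξ : ℕ → Ω → ℝ) (μ : Measure ℝ) (ρ : ℕ → ℝ) : Prop :=
  ∀ n : ℕ, Integrable (record ξ μ n) P ∧ ρ (n + 1) = ∫ ω, record ξ μ n ω ∂P

/-- The moment relation
`(ρ_{n+2} - ρ_{n+1}) / (ρ_2 - ρ_1) = E T^n / (n+1)!` for all `n ≥ 0`, with `τ` the law of `T`. -/
def MomentRelation (ρ : ℕ → ℝ) (τ : Measure ℝ) : Prop :=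
  ∀ n : ℕ, (ρ (n + 2) - ρ (n + 1)) / (ρ 2 - ρ 1) = (∫ t, t ^ n ∂τ) / ((n + 1).factorial : ℝ)

/-! ### The spaces of random variables -/

/-- The function `H : (0,∞) → ℝ` belongs to `ℋ*` (values outside `(0,∞)` are irrelevant). -/
structure IsHStarFun (H : ℝ → ℝ) : Prop where
  nonconstant : ¬ ∃ c : ℝ, ∀ y, 0 < y → H y = c
  monotone : MonotoneOn H (Ioi 0)
  leftContinuous : ∀ y, 0 < y → ContinuousWithinAt H (Iic y) y
  integrable : ∀ m : ℕ, IntegrableOn (fun y => y ^ m * Real.exp (-y) * |H y|) (Ioi 0)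

/-- The function `H : (0,∞) → ℝ` belongs to `ℋ₀`. -/
structure IsHZeroFun (H : ℝ → ℝ) : Prop extends IsHStarFun H where
  integral_zero : ∫ y in Ioi (0 : ℝ), Real.exp (-y) * H y = 0
  integral_one : ∫ y in Ioi (0 : ℝ), y * Real.exp (-y) * H y = 1

/-- A random variable with law `μ` belongs to `ℋ*`. -/
def MemHStar (μ : Measure ℝ) : Prop :=
  IsProbabilityMeasure μ ∧
    ∃ H : ℝ → ℝ, IsHStarFun H ∧ ∀ u ∈ Ioo (0 : ℝ) 1, quantile μ u = H (L u)

/-- A random variable with law `μ` belongs to `ℋ₀`. -/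
def MemHZero (μ : Measure ℝ) : Prop :=
  IsProbabilityMeasure μ ∧
    ∃ H : ℝ → ℝ, IsHZeroFun H ∧ ∀ u ∈ Ioo (0 : ℝ) 1, quantile μ u = H (L u)

/-- A random variable with law `τ` belongs to `𝒯`: it is almost surely positive and has finite
moments of any order. -/
def MemT (τ : Measure ℝ) : Prop :=
  IsProbabilityMeasure τ ∧ (∀ᵐ t ∂τ, 0 < t) ∧ ∀ n : ℕ, Integrable (fun t : ℝ => t ^ n) τ

/-! ### The mapping `φ` -/

/-- The density `f_V = (1-F) L(F) / ∫ (1-F) L(F)`, with `F` the distribution function of `μ`. -/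
def densityV (μ : Measure ℝ) (x : ℝ) : ℝ :=
  (1 - cdf μ x) * L (cdf μ x) / ∫ y, (1 - cdf μ y) * L (cdf μ y)

/-- The law of `V`. -/
def lawV (μ : Measure ℝ) : Measure ℝ :=
  volume.withDensity fun x => ENNReal.ofReal (densityV μ x)

/-- The law of `φ(X) = L(F(V))`, where `X` has law `μ` and distribution function `F`. -/
def phi (μ : Measure ℝ) : Measure ℝ := (lawV μ).map fun x => L (cdf μ x)

/-! ### The mapping `φ'` -/

/-- `(e^y / y) F_T(y-) - ∫_1^y ((x-1)/x²) e^x F_T(x) dx`, for `T` with law `τ`. -/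
def preH (τ : Measure ℝ) (y : ℝ) : ℝ :=
  Real.exp y / y * τ.real (Iio y)
    - ∫ x in (1 : ℝ)..y, (x - 1) / x ^ 2 * Real.exp x * cdf τ x

/-- The constant `c_T`. As `∫_0^∞ e^{-y} dy = 1`, this is the only value of `c` for which
`∫_0^∞ e^{-y} (preH τ y - c) dy = 0`. -/
def cT (τ : Measure ℝ) : ℝ := ∫ y in Ioi (0 : ℝ), Real.exp (-y) * preH τ y

/-- `H₀(y) = (e^y / y) F_T(y-) - ∫_1^y ((x-1)/x²) e^x F_T(x) dx - c_T`, `y > 0`. -/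
def HZero (τ : Measure ℝ) (y : ℝ) : ℝ := preH τ y - cT τ

/-- The function `G₀` on `(0,1)` with `H₀(y) = G₀(1 - e^{-y})`, i.e. `G₀(u) = H₀(-log(1-u))`. -/
def GZero (τ : Measure ℝ) (u : ℝ) : ℝ := HZero τ (L u)

/-- The law of `φ'(T)`, the random variable with inverse distribution function `G₀`: the law of
`G₀(U)` with `U` uniform on `(0,1)`. -/
def phi' (τ : Measure ℝ) : Measure ℝ := (volume.restrict (Ioo (0 : ℝ) 1)).map (GZero τ)

end

end RecordSeq

namespace RecordSeq

open scoped ENNReal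

/-! Number records from 0. The record of order `n` of a uniform sample has density `L u ^ n / n!` on
(0,1) (`map_recordValue`). With u = 1 - e^{-y} and inverse distribution function H ∘ L, the expected
record is therefore the integral of H against the gamma density e^{-y} y^n / n!. The difference of
two consecutive expected records is the integral of H against the kernel `gammaDiff n`. This kernel
has total mass 0, and its mass on (t, ∞) is e^{-t} t^{n+1} / (n+1)! (`integral_gammaDiff_Ioi`).
Hence additive constants in H do not matter, and a step 1_{y > t} contributes exactly this tail
mass.

Both halves write H, up to a constant, as an average of such steps and exchange integrals
(`integral_kernel_mul_eq`). For φ, H(y) - H(1) is the integral over x of 1_{x < H(y)} - 1_{x <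
H(1)}, and x < H(y) means y > L(F(x)) when F(x) < 1. The difference of expected records becomes the
integral of (1-F) L(F)^{n+1} / (n+1)! (`integrable_and_integral_tail`), a moment of φ(X) up to
normalisation. For φ', Fubini turns `preH` into a constant plus the τ-average of (e^t/t)(1_{t < y} -
1_{t < 1}) (`integrable_stepDiff_and_preH_eq`). The weight e^t/t is the one that turns the tail mass
into t^n / (n+1)! (`integral_gammaDiff_mul_HZero`).

The law of the records comes from decomposing by record times: waiting for the next record produces
a geometric series with sum 1/(1-u), and 1/(1-u) is the derivative of L
(`tsum_lintegral_recordWeight`). -/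

/-- The standard uniform law. -/
noncomputable abbrev unitUniform : Measure ℝ := volume.restrict (Ioo (0 : ℝ) 1)

instance : IsProbabilityMeasure unitUniform := ⟨by simp [unitUniform]⟩

/-! ### Independence in a uniform sample. -/

variable {Ω : Type*} [MeasurableSpace Ω] {P : Measure Ω} {ξ : ℕ → Ω → ℝ}

theorem IsUniformSample.map_eq (hξ : IsUniformSample P ξ) (i : ℕ) :
    P.map (ξ i) = unitUniform := by
  have h := hξ.uniform i
  rw [pdf.IsUniform] at h
  rw [h, ProbabilityTheory.cond]
  simp [unitUniform]

/-- Integrating out the next term of the sample, which is independent of the previous ones. -/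
theorem IsUniformSample.lintegral_next [IsProbabilityMeasure P] (hξ : IsUniformSample P ξ) (m : ℕ)
    {F : (ℕ → ℝ) → ℝ → ℝ≥0∞} (hF : Measurable (Function.uncurry F))
    (hdep : ∀ x y v, (∀ i < m, x i = y i) → F x v = F y v) :
    ∫⁻ ω, F (fun i => ξ i ω) (ξ m ω) ∂P
      = ∫⁻ ω, ∫⁻ v, F (fun i => ξ i ω) v ∂unitUniform ∂P := by
  have hdisj : Disjoint (Finset.range m) {m} := by simp
  have hind := hξ.indep.indepFun_finset (Finset.range m) {m} hdisj hξ.measurable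
  set X : Ω → (Finset.range m → ℝ) := fun ω i => ξ i ω with hX
  -- Padding by 0 is harmless: by `hdep`, `F` only sees the coordinates below `m`.
  let e : (Finset.range m → ℝ) → (ℕ → ℝ) := fun z i => if h : i ∈ Finset.range m then z ⟨i, h⟩ else 0
  have he : Measurable e := by
    refine measurable_pi_lambda _ fun i => ?_
    by_cases h : i ∈ Finset.range m
    · simp only [e, h, dite_true]; exact measurable_pi_apply _
    · simp only [e, h, dite_false]; exact measurable_const
  have hXm : Measurable X := measurable_pi_lambda _ fun i => hξ.measurable i
  have hind' : X ⟂ᵢ[P] (ξ m) :=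
    hind.comp (φ := id) (ψ := fun z : (({m} : Finset ℕ) → ℝ) => z ⟨m, by simp⟩) measurable_id
      (measurable_pi_apply _)
  rw [indepFun_iff_map_prod_eq_prod_map_map hXm.aemeasurable (hξ.measurable m).aemeasurable,
    hξ.map_eq] at hind'
  have hFe : ∀ ω v, F (fun i => ξ i ω) v = F (e (X ω)) v := fun ω v =>
    hdep _ _ v fun i hi => by simp [e, hX, hi]
  have hG : Measurable fun p : (Finset.range m → ℝ) × ℝ => F (e p.1) p.2 :=
    hF.comp ((he.comp measurable_fst).prodMk measurable_snd)
  calc ∫⁻ ω, F (fun i => ξ i ω) (ξ m ω) ∂P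
      = ∫⁻ ω, (fun p : (Finset.range m → ℝ) × ℝ => F (e p.1) p.2) (X ω, ξ m ω) ∂P :=
        lintegral_congr fun ω => hFe ω _
    _ = ∫⁻ p, F (e p.1) p.2 ∂((P.map X).prod unitUniform) := by
        rw [← hind', lintegral_map hG (hXm.prodMk (hξ.measurable m))]
    _ = ∫⁻ z, ∫⁻ v, F (e z) v ∂unitUniform ∂(P.map X) := lintegral_prod _ hG.aemeasurable
    _ = ∫⁻ ω, ∫⁻ v, F (e (X ω)) v ∂unitUniform ∂P :=
        lintegral_map (f := fun z => ∫⁻ v, F (e z) v ∂unitUniform) hG.lintegral_prod_right' hXm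
    _ = _ := lintegral_congr fun ω => lintegral_congr fun v => (hFe ω v).symm

/-! ### Record times -/

/-- The indicator of the event that the `k` terms following the term `t` do not exceed it. -/
noncomputable def stayWeight (t k : ℕ) (x : ℕ → ℝ) : ℝ≥0∞ :=
  ∏ j ∈ Finset.range k, (Iic (x t)).indicator 1 (x (t + 1 + j))

/-- The indicator of the event that `m` is the record time number `n`. -/
noncomputable def recordWeight : ℕ → ℕ → (ℕ → ℝ) → ℝ≥0∞
  | 0, m, _ => if m = 0 then 1 else 0
  | n + 1, m, x => ∑' t, ∑' k, if t + 1 + k = m then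
      recordWeight n t x * stayWeight t k x * (Ioi (x t)).indicator 1 (x (t + 1 + k)) else 0

theorem measurable_indicator_Iic {α : Type*} [MeasurableSpace α] {f g : α → ℝ}
    (hf : Measurable f) (hg : Measurable g) :
    Measurable fun a => (Iic (f a)).indicator (1 : ℝ → ℝ≥0∞) (g a) := by
  have : (fun a => (Iic (f a)).indicator (1 : ℝ → ℝ≥0∞) (g a))
      = {a | g a ≤ f a}.indicator 1 := by
    ext a; simp [indicator]
  rw [this]
  exact measurable_one.indicator (measurableSet_le hg hf)

theorem measurable_indicator_Ioi {α : Type*} [MeasurableSpace α] {f g : α → ℝ}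
    (hf : Measurable f) (hg : Measurable g) :
    Measurable fun a => (Ioi (f a)).indicator (1 : ℝ → ℝ≥0∞) (g a) := by
  have : (fun a => (Ioi (f a)).indicator (1 : ℝ → ℝ≥0∞) (g a))
      = {a | f a < g a}.indicator 1 := by
    ext a; simp [indicator]
  rw [this]
  exact measurable_one.indicator (measurableSet_lt hf hg)

theorem measurable_stayWeight (t k : ℕ) : Measurable (stayWeight t k) := by
  unfold stayWeight
  exact Finset.measurable_fun_prod _ fun j _ =>
    measurable_indicator_Iic (measurable_pi_apply _) (measurable_pi_apply _)

theorem measurable_recordWeight (n m : ℕ) : Measurable (recordWeight n m) := by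
  induction n generalizing m with
  | zero =>
    change Measurable fun x => recordWeight 0 m x
    simp only [recordWeight, measurable_const]
  | succ n ih =>
    change Measurable fun x => recordWeight (n + 1) m x
    simp only [recordWeight]
    refine Measurable.tsum fun t => Measurable.tsum fun k => ?_
    split_ifs
    · exact ((ih t).mul (measurable_stayWeight t k)).mul
        (measurable_indicator_Ioi (measurable_pi_apply _) (measurable_pi_apply _))
    · exact measurable_const

theorem stayWeight_congr {t k : ℕ} {x y : ℕ → ℝ} (h : ∀ i < t + 1 + k, x i = y i) :
    stayWeight t k x = stayWeight t k y := by
  unfold stayWeight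
  refine Finset.prod_congr rfl fun j hj => ?_
  rw [Finset.mem_range] at hj
  rw [h t (by omega), h (t + 1 + j) (by omega)]

theorem recordWeight_congr {n m : ℕ} {x y : ℕ → ℝ} (h : ∀ i < m + 1, x i = y i) :
    recordWeight n m x = recordWeight n m y := by
  induction n generalizing m with
  | zero => rfl
  | succ n ih =>
    simp only [recordWeight]
    refine tsum_congr fun t => tsum_congr fun k => ?_
    split_ifs with hm
    · rw [ih fun i hi => h i (by omega), stayWeight_congr fun i hi => h i (by omega),
        h t (by omega), h (t + 1 + k) (by omega)]
    · rfl

theorem recordTime_succ_eq {x : ℕ → ℝ} {n t k : ℕ} (ht : recordTime x n = t)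
    (hs : stayWeight t k x ≠ 0) (hlt : x t < x (t + 1 + k)) :
    recordTime x (n + 1) = t + 1 + k := by
  simp only [recordTime, ht]
  refine (IsLeast.csInf_eq ⟨⟨by omega, hlt⟩, ?_⟩)
  rintro m ⟨h1, h2⟩
  by_contra! hm
  rw [stayWeight, Finset.prod_ne_zero_iff] at hs
  have := hs (m - (t + 1)) (by rw [Finset.mem_range]; omega)
  rw [show t + 1 + (m - (t + 1)) = m by omega] at this
  have := mem_of_indicator_ne_zero this
  exact absurd this (not_le.2 h2)

theorem stayWeight_le_one (t k : ℕ) (x : ℕ → ℝ) : stayWeight t k x ≤ 1 :=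
  Finset.prod_le_one' fun _ _ => indicator_le_self' (f := (1 : ℝ → ℝ≥0∞)) (by simp) _

/-- Only this implication holds. If no later term exceeds the current record, `sInf ∅ = 0` makes the
next `recordTime` 0, while every weight of the next order vanishes. This is why
`tsum_recordWeight_mul_le` is an inequality. -/
theorem recordTime_eq_of_recordWeight_ne_zero {n m : ℕ} {x : ℕ → ℝ} (h : recordWeight n m x ≠ 0) :
    recordTime x n = m := by
  induction n generalizing m with
  | zero =>
    simp only [recordWeight, ne_eq, ite_eq_right_iff, one_ne_zero, imp_false, not_not] at h
    simp [recordTime, h]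
  | succ n ih =>
    simp only [recordWeight, ne_eq, ENNReal.tsum_eq_zero, not_forall] at h
    obtain ⟨t, k, h⟩ := h
    split_ifs at h with hm
    · rw [← hm]
      simp only [mul_eq_zero, not_or] at h
      exact recordTime_succ_eq (ih h.1.1) h.1.2 (mem_of_indicator_ne_zero h.2)
    · exact absurd rfl h

theorem recordWeight_le_one (n m : ℕ) (x : ℕ → ℝ) : recordWeight n m x ≤ 1 := by
  induction n generalizing m with
  | zero => simp only [recordWeight]; split_ifs <;> simp
  | succ n ih =>
    simp only [recordWeight]
    -- At most one pair `(t, k)` contributes. If `m` is smaller than `t + 1`, truncated subtraction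
    -- gives `k = 0`, the condition `t + 1 + k = m` fails and the term is 0.
    rw [tsum_eq_single (recordTime x n), tsum_eq_single (m - (recordTime x n + 1))]
    · split_ifs
      · exact mul_le_one' (mul_le_one' (ih _) (stayWeight_le_one _ _ _))
          (indicator_le_self' (f := (1 : ℝ → ℝ≥0∞)) (by simp) _)
      · simp
    · intro k hk
      rw [if_neg (by omega)]
    · intro t ht
      have : recordWeight n t x = 0 := by
        by_contra h
        exact ht (recordTime_eq_of_recordWeight_ne_zero h).symm
      simp [this]

theorem tsum_recordWeight_mul_le (n : ℕ) (x : ℕ → ℝ) (g : ℝ → ℝ≥0∞) :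
    ∑' m, recordWeight n m x * g (x m) ≤ g (recordValue x n) := by
  rw [tsum_eq_single (recordTime x n)]
  · exact mul_le_of_le_one_left zero_le (recordWeight_le_one _ _ _)
  · intro t ht
    have : recordWeight n t x = 0 := by
      by_contra h
      exact ht (recordTime_eq_of_recordWeight_ne_zero h).symm
    simp [this]

theorem measurable_recordTime (n : ℕ) : Measurable fun x : ℕ → ℝ => recordTime x n := by
  induction n with
  | zero => exact measurable_const
  | succ n ih =>
    let S : ℕ → (ℕ → ℝ) → Set ℕ := fun t x => {m | t < m ∧ x t < x m}
    have hS : ∀ t m, MeasurableSet {x | m ∈ S t x} := fun t m =>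
      (MeasurableSet.const _).inter
        (measurableSet_lt (measurable_pi_apply t) (measurable_pi_apply m))
    have key : ∀ t, Measurable fun x => sInf (S t x) := by
      intro t
      -- The value 0 is set apart: it is also the infimum of the empty set, and it is handled as the
      -- complement of the positive values.
      have h0 : ∀ m, 0 < m → MeasurableSet ((fun x => sInf (S t x)) ⁻¹' {m}) := by
        intro m hm
        have : ((fun x => sInf (S t x)) ⁻¹' {m})
            = {x | m ∈ S t x} ∩ ⋂ j ∈ Iio m, {x | j ∈ S t x}ᶜ := by
          ext x
          simp only [mem_preimage, mem_singleton_iff, mem_inter_iff, mem_ofPred_eq, mem_iInter,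
            mem_compl_iff]
          constructor
          · intro h
            have hne : (S t x).Nonempty := by
              by_contra hne
              rw [not_nonempty_iff_eq_empty] at hne
              rw [hne, Nat.sInf_empty] at h
              omega
            exact ⟨h ▸ Nat.sInf_mem hne, fun j hj hmem => by
              have := Nat.sInf_le hmem
              rw [mem_Iio] at hj; omega⟩
          · rintro ⟨h1, h2⟩
            refine IsLeast.csInf_eq ⟨h1, fun j hj => ?_⟩
            by_contra! hlt
            exact h2 j hlt hj
        rw [this]
        exact (hS t m).inter (MeasurableSet.biInter (to_countable _) fun j _ => (hS t j).compl)
      refine measurable_to_countable' fun m => ?_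
      rcases Nat.eq_zero_or_pos m with rfl | hm
      · have : ((fun x => sInf (S t x)) ⁻¹' {0})
            = (⋃ m ∈ Ioi (0 : ℕ), ((fun x => sInf (S t x)) ⁻¹' {m}))ᶜ := by
          ext x
          simp only [mem_preimage, mem_singleton_iff, mem_compl_iff, mem_iUnion, mem_Ioi,
            Nat.pos_iff_ne_zero, exists_prop, not_exists, not_and]
          exact ⟨fun h m hm h' => hm (h'.symm.trans h), fun h => by_contra fun h' => h _ h' rfl⟩
        rw [this]
        exact (MeasurableSet.biUnion (to_countable _) fun m hm => h0 m hm).compl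
      · exact h0 m hm
    have hpair : Measurable fun p : ℕ × (ℕ → ℝ) => sInf (S p.1 p.2) :=
      measurable_from_prod_countable_right key
    exact hpair.comp (ih.prodMk measurable_id)

theorem measurable_recordValue (n : ℕ) : Measurable fun x : ℕ → ℝ => recordValue x n := by
  have hpair : Measurable fun p : ℕ × (ℕ → ℝ) => p.2 p.1 :=
    measurable_from_prod_countable_right fun t => measurable_pi_apply t
  exact hpair.comp ((measurable_recordTime n).prodMk measurable_id)

/-! ### The law of the record values -/

theorem measurable_unitUniform_Iic : Measurable fun a : ℝ => unitUniform (Iic a) :=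
  (Monotone.measurable fun _ _ h => measure_mono (Iic_subset_Iic.2 h))

/-- Induction peels off the last term, which is independent of the earlier ones and stays below the
term `t` with conditional probability `unitUniform (Iic (ξ t ω))`. This factor depends only on the
term `t`, so it can be absorbed into `G`. -/
theorem lintegral_stayWeight [IsProbabilityMeasure P] (hξ : IsUniformSample P ξ) (t k : ℕ)
    {G : (ℕ → ℝ) → ℝ≥0∞} (hG : Measurable G)
    (hdep : ∀ x y, (∀ i < t + 1, x i = y i) → G x = G y) :
    ∫⁻ ω, G (fun i => ξ i ω) * stayWeight t k (fun i => ξ i ω) ∂P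
      = ∫⁻ ω, G (fun i => ξ i ω) * unitUniform (Iic (ξ t ω)) ^ k ∂P := by
  induction k generalizing G with
  | zero => simp [stayWeight]
  | succ k ih =>
    let F : (ℕ → ℝ) → ℝ → ℝ≥0∞ := fun x v =>
      G x * stayWeight t k x * (Iic (x t)).indicator 1 v
    have hF : Measurable (Function.uncurry F) :=
      ((hG.comp measurable_fst).mul ((measurable_stayWeight t k).comp measurable_fst)).mul
        (measurable_indicator_Iic ((measurable_pi_apply t).comp measurable_fst) measurable_snd)
    have h1 := hξ.lintegral_next (t + 1 + k) hF (fun x y v h => by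
      simp only [F]
      rw [hdep x y fun i hi => h i (by omega), stayWeight_congr fun i hi => h i (by omega),
        h t (by omega)])
    calc ∫⁻ ω, G (fun i => ξ i ω) * stayWeight t (k + 1) (fun i => ξ i ω) ∂P
        = ∫⁻ ω, F (fun i => ξ i ω) (ξ (t + 1 + k) ω) ∂P := by
          refine lintegral_congr fun ω => ?_
          simp only [F, stayWeight, Finset.prod_range_succ, mul_assoc]
      _ = ∫⁻ ω, (fun x => G x * unitUniform (Iic (x t))) (fun i => ξ i ω)
            * stayWeight t k (fun i => ξ i ω) ∂P := by
          rw [h1]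
          refine lintegral_congr fun ω => ?_
          simp only [F]
          rw [lintegral_const_mul _ (measurable_one.indicator measurableSet_Iic),
            lintegral_indicator_one measurableSet_Iic]
          ring
      _ = _ := by
          rw [ih (G := fun x => G x * unitUniform (Iic (x t))) (hG.mul (measurable_unitUniform_Iic.comp (measurable_pi_apply t)))
            fun x y h => by rw [hdep x y h, h t (by omega)]]
          refine lintegral_congr fun ω => ?_
          ring

/-- The term in position `t + 1 + k`, which carries the new record, is integrated out first; the `k`
terms before it then follow from `lintegral_stayWeight`. -/
theorem lintegral_recordWeight_step [IsProbabilityMeasure P] (hξ : IsUniformSample P ξ) (n t k : ℕ)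
    {g : ℝ → ℝ≥0∞} (hg : Measurable g) :
    ∫⁻ ω, recordWeight n t (fun i => ξ i ω) * stayWeight t k (fun i => ξ i ω)
        * (Ioi (ξ t ω)).indicator 1 (ξ (t + 1 + k) ω) * g (ξ (t + 1 + k) ω) ∂P
      = ∫⁻ ω, recordWeight n t (fun i => ξ i ω) * (∫⁻ v in Ioi (ξ t ω), g v ∂unitUniform)
          * unitUniform (Iic (ξ t ω)) ^ k ∂P := by
  let F : (ℕ → ℝ) → ℝ → ℝ≥0∞ := fun x v =>
      recordWeight n t x * stayWeight t k x * (Ioi (x t)).indicator 1 v * g v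
  have hind : Measurable fun p : (ℕ → ℝ) × ℝ => (Ioi (p.1 t)).indicator (1 : ℝ → ℝ≥0∞) p.2 :=
    measurable_indicator_Ioi ((measurable_pi_apply t).comp measurable_fst) measurable_snd
  have hF : Measurable (Function.uncurry F) :=
    ((((measurable_recordWeight n t).comp measurable_fst).mul
      ((measurable_stayWeight t k).comp measurable_fst)).mul hind).mul (hg.comp measurable_snd)
  have h1 := hξ.lintegral_next (t + 1 + k) hF (fun x y v h => by
      simp only [F]
      rw [recordWeight_congr fun i hi => h i (by omega),
        stayWeight_congr fun i hi => h i (by omega), h t (by omega)])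
  have hset : ∀ a : ℝ, ∫⁻ v in Ioi a, g v ∂unitUniform
      = ∫⁻ v, (Ioi a).indicator 1 v * g v ∂unitUniform := fun a => by
    rw [← lintegral_indicator measurableSet_Ioi]
    refine lintegral_congr fun v => ?_
    by_cases hv : v ∈ Ioi a <;> simp [hv, indicator]
  have hh : Measurable fun x : ℕ → ℝ => ∫⁻ v in Ioi (x t), g v ∂unitUniform := by
    simp only [hset]
    exact (hind.mul (hg.comp measurable_snd)).lintegral_prod_right'
  refine h1.trans ?_
  rw [← lintegral_stayWeight hξ t k (G := fun x => recordWeight n t x *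
    ∫⁻ v in Ioi (x t), g v ∂unitUniform) ((measurable_recordWeight n t).mul hh) (fun x y h => by
      rw [recordWeight_congr h, h t (by omega)])]
  refine lintegral_congr fun ω => ?_
  simp only [F, mul_assoc]
  rw [lintegral_const_mul, lintegral_const_mul, hset]
  · ring
  · exact (measurable_one.indicator measurableSet_Ioi).mul hg
  · exact ((measurable_one.indicator measurableSet_Ioi).mul hg).const_mul _

theorem measurable_L : Measurable L :=
  (Real.measurable_log.comp (measurable_const.sub measurable_id)).neg

theorem hasDerivAt_L {u : ℝ} (hu : u < 1) : HasDerivAt L (1 - u)⁻¹ u := by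
  have := (((hasDerivAt_id u).const_sub 1).log (by simp; linarith)).neg
  refine this.congr_deriv ?_
  simp [neg_div]

theorem L_nonneg {u : ℝ} (hu : 0 ≤ u) (hu1 : u ≤ 1) : 0 ≤ L u :=
  neg_nonneg.2 (Real.log_nonpos (by linarith) (by linarith))

/-- Since 1/(1-u) is the derivative of L, this is the recursion that carries one record density to
the next. -/
theorem lintegral_L_pow_div (n : ℕ) {v : ℝ} (hv : v ∈ Ioo (0 : ℝ) 1) :
    ∫⁻ u in Ioo 0 v, (ENNReal.ofReal (1 - u))⁻¹ * ENNReal.ofReal (L u ^ n / n.factorial)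
      = ENNReal.ofReal (L v ^ (n + 1) / (n + 1).factorial) := by
  have hder : ∀ u ∈ uIcc 0 v, HasDerivAt (fun u => L u ^ (n + 1) / (n + 1).factorial)
      ((1 - u)⁻¹ * (L u ^ n / n.factorial)) u := by
    intro u hu
    rw [uIcc_of_le hv.1.le] at hu
    have := ((hasDerivAt_L (u := u) (by linarith [hu.2, hv.2])).pow (n + 1)).div_const
      ((n + 1).factorial : ℝ)
    refine this.congr_deriv ?_
    rw [Nat.factorial_succ]
    push_cast
    have : (n.factorial : ℝ) ≠ 0 := by positivity
    field_simp
  have hcont : ContinuousOn (fun u => (1 - u)⁻¹ * (L u ^ n / n.factorial)) (uIcc 0 v) := by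
    rw [uIcc_of_le hv.1.le]
    intro u hu
    have h1 : u < 1 := by linarith [hu.2, hv.2]
    refine ContinuousAt.continuousWithinAt ?_
    exact (ContinuousAt.inv₀ (by fun_prop) (by linarith)).mul
      (((hasDerivAt_L h1).continuousAt.pow n).div_const _)
  have hint := hcont.intervalIntegrable (μ := volume)
  have hF := intervalIntegral.integral_eq_sub_of_hasDerivAt hder hint
  rw [intervalIntegrable_iff_integrableOn_Ioo_of_le hv.1.le] at hint
  rw [intervalIntegral.integral_of_le hv.1.le, integral_Ioc_eq_integral_Ioo] at hF
  have hL0 : L 0 = 0 := by simp [L]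
  rw [hL0, zero_pow (by omega), zero_div, sub_zero] at hF
  rw [← hF, ofReal_integral_eq_lintegral_ofReal hint]
  · refine setLIntegral_congr_fun measurableSet_Ioo fun u hu => ?_
    have h1 : 0 < 1 - u := by linarith [hu.2, hv.2]
    rw [ENNReal.ofReal_mul (by positivity), ENNReal.ofReal_inv_of_pos h1]
  · refine (ae_restrict_mem measurableSet_Ioo).mono fun u hu => ?_
    have h1 : 0 < 1 - u := by linarith [hu.2, hv.2]
    have := L_nonneg hu.1.le (by linarith)
    simp only [Pi.zero_apply]
    positivity

/-- Induction along the Markov chain of record values: summing over waiting times gives a geometric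
series, and Tonelli moves the transition kernel from the test function to the density. All sums are
in `ℝ≥0∞`, so no convergence has to be checked. -/
theorem tsum_lintegral_recordWeight [IsProbabilityMeasure P] (hξ : IsUniformSample P ξ) (n : ℕ)
    {g : ℝ → ℝ≥0∞} (hg : Measurable g) :
    ∑' m, ∫⁻ ω, recordWeight n m (fun i => ξ i ω) * g (ξ m ω) ∂P
      = ∫⁻ u, g u * ENNReal.ofReal (L u ^ n / n.factorial) ∂unitUniform := by
  induction n generalizing g with
  | zero =>
    rw [tsum_eq_single 0 (fun m hm => by simp [recordWeight, hm])]
    simp only [recordWeight, if_true, one_mul, pow_zero, Nat.factorial_zero, Nat.cast_one, div_one,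
      ENNReal.ofReal_one, mul_one]
    rw [← hξ.map_eq 0, lintegral_map hg (hξ.measurable 0)]
  | succ n ih =>
    have hX : Measurable fun ω i => ξ i ω := measurable_pi_lambda _ hξ.measurable
    let h : ℝ → ℝ≥0∞ := fun a => ∫⁻ v in Ioi a, g v ∂unitUniform
    have hind : Measurable fun p : ℝ × ℝ => (Ioi p.1).indicator (1 : ℝ → ℝ≥0∞) p.2 * g p.2 :=
      (measurable_indicator_Ioi measurable_fst measurable_snd).mul (hg.comp measurable_snd)
    have hh' : ∀ a, h a = ∫⁻ v, (Ioi a).indicator 1 v * g v ∂unitUniform := fun a => by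
      simp only [h]
      rw [← lintegral_indicator measurableSet_Ioi]
      refine lintegral_congr fun v => ?_
      by_cases hv : v ∈ Ioi a <;> simp [hv, indicator]
    have hh : Measurable h := by
      rw [funext hh']
      exact hind.lintegral_prod_right'
    -- For a in (0,1), `q a` is the mean of `g` under the uniform law on (a,1), the law of the next
    -- record after a record `a`.
    let q : ℝ → ℝ≥0∞ := fun a => h a * (1 - unitUniform (Iic a))⁻¹
    have hq : Measurable q := hh.mul (measurable_const.sub measurable_unitUniform_Iic).inv
    have hT : ∀ t k, Measurable fun ω => recordWeight n t (fun i => ξ i ω)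
        * stayWeight t k (fun i => ξ i ω)
        * (Ioi (ξ t ω)).indicator (1 : ℝ → ℝ≥0∞) (ξ (t + 1 + k) ω) * g (ξ (t + 1 + k) ω) :=
      fun t k => ((((measurable_recordWeight n t).comp hX).mul
        ((measurable_stayWeight t k).comp hX)).mul
        (measurable_indicator_Ioi (hξ.measurable _) (hξ.measurable _))).mul
        (hg.comp (hξ.measurable _))
    calc ∑' m, ∫⁻ ω, recordWeight (n + 1) m (fun i => ξ i ω) * g (ξ m ω) ∂P
        = ∑' m, ∑' t, ∑' k, if t + 1 + k = m then
            ∫⁻ ω, recordWeight n t (fun i => ξ i ω) * stayWeight t k (fun i => ξ i ω)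
            * (Ioi (ξ t ω)).indicator 1 (ξ (t + 1 + k) ω) * g (ξ (t + 1 + k) ω) ∂P else 0 := by
          refine tsum_congr fun m => ?_
          simp only [recordWeight, ← ENNReal.tsum_mul_right]
          have hm : ∀ t k, Measurable fun ω => (if t + 1 + k = m then
              recordWeight n t (fun i => ξ i ω) * stayWeight t k (fun i => ξ i ω)
              * (Ioi (ξ t ω)).indicator (1 : ℝ → ℝ≥0∞) (ξ (t + 1 + k) ω) else 0) * g (ξ m ω) := by
            intro t k
            by_cases hm : t + 1 + k = m
            · simp only [hm, if_true]
              have := hT t k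
              rwa [hm] at this
            · simp [hm]
          rw [lintegral_tsum fun t => (Measurable.tsum fun k => hm t k).aemeasurable]
          refine tsum_congr fun t => ?_
          rw [lintegral_tsum fun k => (hm t k).aemeasurable]
          refine tsum_congr fun k => ?_
          split_ifs with hm
          · simp only [hm]
          · simp
      _ = ∑' t, ∑' k, ∫⁻ ω, recordWeight n t (fun i => ξ i ω) * stayWeight t k (fun i => ξ i ω)
            * (Ioi (ξ t ω)).indicator 1 (ξ (t + 1 + k) ω) * g (ξ (t + 1 + k) ω) ∂P := by
          rw [ENNReal.tsum_comm]
          refine tsum_congr fun t => ?_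
          rw [ENNReal.tsum_comm]
          refine tsum_congr fun k => ?_
          rw [tsum_eq_single (t + 1 + k) (fun m hm => if_neg (Ne.symm hm)), if_pos rfl]
      _ = ∑' t, ∫⁻ ω, recordWeight n t (fun i => ξ i ω) * q (ξ t ω) ∂P := by
          refine tsum_congr fun t => ?_
          simp only [lintegral_recordWeight_step hξ n t _ hg]
          rw [← lintegral_tsum]
          · refine lintegral_congr fun ω => ?_
            rw [ENNReal.tsum_mul_left, ENNReal.tsum_geometric, mul_assoc]
          · exact fun k => ((((measurable_recordWeight n t).comp hX).mul
              (hh.comp (hξ.measurable t))).mul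
              ((measurable_unitUniform_Iic.comp (hξ.measurable t)).pow_const k)).aemeasurable
      _ = ∫⁻ u, q u * ENNReal.ofReal (L u ^ n / n.factorial) ∂unitUniform := ih hq
      _ = ∫⁻ u, ∫⁻ v, (Ioi u).indicator 1 v * g v * ((1 - unitUniform (Iic u))⁻¹
            * ENNReal.ofReal (L u ^ n / n.factorial)) ∂unitUniform ∂unitUniform := by
          refine lintegral_congr fun u => ?_
          have := lintegral_mul_const (μ := unitUniform) ((1 - unitUniform (Iic u))⁻¹
            * ENNReal.ofReal (L u ^ n / n.factorial))
            (f := fun v => (Ioi u).indicator 1 v * g v)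
            ((measurable_one.indicator measurableSet_Ioi).mul hg)
          rw [this, ← hh' u, ← mul_assoc]
      _ = ∫⁻ v, ∫⁻ u, (Ioi u).indicator 1 v * g v * ((1 - unitUniform (Iic u))⁻¹
            * ENNReal.ofReal (L u ^ n / n.factorial)) ∂unitUniform ∂unitUniform := by
          refine lintegral_lintegral_swap (Measurable.aemeasurable ?_)
          refine hind.mul (Measurable.mul ?_ ?_)
          · exact ((measurable_const.sub measurable_unitUniform_Iic).comp measurable_fst).inv
          · exact (((measurable_L.pow_const n).div_const _).comp measurable_fst).ennreal_ofReal
      _ = _ := by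
          refine setLIntegral_congr_fun measurableSet_Ioo fun v hv => ?_
          rw [← lintegral_L_pow_div n hv, ← lintegral_const_mul, ← lintegral_indicator
            measurableSet_Ioo, ← lintegral_indicator measurableSet_Ioo]
          · refine lintegral_congr fun u => ?_
            by_cases hu : u ∈ Ioo 0 v
            · have hu1 : u ∈ Ioo (0 : ℝ) 1 := ⟨hu.1, hu.2.trans hv.2⟩
              have hvol : unitUniform (Iic u) = ENNReal.ofReal u := by
                rw [Measure.restrict_apply measurableSet_Iic]
                have : Iic u ∩ Ioo 0 1 = Ioc 0 u := by
                  ext a; simp only [mem_inter_iff, mem_Iic, mem_Ioo, mem_Ioc]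
                  constructor
                  · tauto
                  · rintro ⟨h1, h2⟩; exact ⟨h2, h1, by linarith [hu1.2]⟩
                rw [this]; simp
              rw [indicator_of_mem hu, indicator_of_mem hu1, indicator_of_mem (by exact hu.2), hvol,
                ENNReal.ofReal_sub _ hu.1.le]
              simp
            · rw [indicator_of_notMem hu]
              by_cases hu1 : u ∈ Ioo (0 : ℝ) 1
              · rw [indicator_of_mem hu1, indicator_of_notMem]
                · simp
                · intro h'; exact hu ⟨hu1.1, h'⟩
              · rw [indicator_of_notMem hu1]
          · exact (ENNReal.measurable_ofReal.comp (measurable_const.sub measurable_id)).inv.mul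
              ((measurable_L.pow_const n).div_const _).ennreal_ofReal

end RecordSeq

namespace RecordSeq

open scoped ENNReal

variable {Ω : Type*} [MeasurableSpace Ω] {P : Measure Ω} {ξ : ℕ → Ω → ℝ}

/-! ### The exponential change of variables -/

theorem L_one_sub_exp_neg (y : ℝ) : L (1 - Real.exp (-y)) = y := by simp [L]

theorem one_sub_exp_neg_mem {y : ℝ} (hy : 0 < y) : 1 - Real.exp (-y) ∈ Ioo (0 : ℝ) 1 := by
  have h1 : Real.exp (-y) < 1 := by simpa using hy
  have h2 := Real.exp_pos (-y)
  exact ⟨by linarith, by linarith⟩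

theorem exp_neg_L {u : ℝ} (hu : u < 1) : Real.exp (-L u) = 1 - u := by
  rw [L, neg_neg, Real.exp_log (by linarith)]

theorem L_pos {u : ℝ} (hu : u ∈ Ioo (0 : ℝ) 1) : 0 < L u :=
  neg_pos.2 (Real.log_neg (by linarith [hu.2]) (by linarith [hu.1]))

theorem L_le_L {u v : ℝ} (huv : u ≤ v) (hv : v < 1) : L u ≤ L v :=
  neg_le_neg (Real.log_le_log (by linarith) (by linarith))

theorem image_one_sub_exp_neg : (fun y : ℝ => 1 - Real.exp (-y)) '' Ioi 0 = Ioo 0 1 := by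
  ext u
  constructor
  · rintro ⟨y, hy, rfl⟩
    exact one_sub_exp_neg_mem hy
  · intro hu
    exact ⟨L u, L_pos hu, by simp only [exp_neg_L hu.2]; ring⟩

theorem hasDerivWithinAt_one_sub_exp_neg (y : ℝ) (s : Set ℝ) :
    HasDerivWithinAt (fun y : ℝ => 1 - Real.exp (-y)) (Real.exp (-y)) s y := by
  have := ((hasDerivAt_neg y).exp.const_sub 1).hasDerivWithinAt (s := s)
  exact this.congr_deriv (by ring)

theorem injOn_one_sub_exp_neg (s : Set ℝ) : InjOn (fun y : ℝ => 1 - Real.exp (-y)) s :=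
  Function.Injective.injOn fun x y h => by
    rw [← L_one_sub_exp_neg x, ← L_one_sub_exp_neg y]; exact congrArg L h

/-- `L` carries the uniform law to the standard exponential law. The substitution u = 1 - e^{-y} is
injective, so the change of variables needs no measurability of `f`. -/
theorem integral_comp_L (f : ℝ → ℝ) :
    ∫ u, f (L u) ∂unitUniform = ∫ y in Ioi (0 : ℝ), Real.exp (-y) * f y := by
  rw [unitUniform, ← image_one_sub_exp_neg, integral_image_eq_integral_abs_deriv_smul
    measurableSet_Ioi (fun y _ => hasDerivWithinAt_one_sub_exp_neg y _) (injOn_one_sub_exp_neg _)]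
  simp [L_one_sub_exp_neg]

theorem integrable_comp_L_iff (f : ℝ → ℝ) :
    Integrable (fun u => f (L u)) unitUniform
      ↔ IntegrableOn (fun y => Real.exp (-y) * f y) (Ioi 0) := by
  rw [unitUniform, ← image_one_sub_exp_neg, ← IntegrableOn,
    integrableOn_image_iff_integrableOn_abs_deriv_smul
    measurableSet_Ioi (fun y _ => hasDerivWithinAt_one_sub_exp_neg y _) (injOn_one_sub_exp_neg _)]
  simp [L_one_sub_exp_neg]

theorem integrableOn_exp_neg_mul_pow (n : ℕ) :
    IntegrableOn (fun y : ℝ => Real.exp (-y) * y ^ n) (Ioi 0) := by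
  simpa using Real.GammaIntegral_convergent (s := n + 1) (by positivity)

theorem integral_exp_neg_mul_pow (n : ℕ) :
    ∫ y in Ioi (0 : ℝ), Real.exp (-y) * y ^ n = n.factorial := by
  simpa [Real.Gamma_nat_eq_factorial] using
    (Real.Gamma_eq_integral (s := n + 1) (by positivity)).symm

theorem lintegral_record_density (n : ℕ) :
    ∫⁻ u, ENNReal.ofReal (L u ^ n / n.factorial) ∂unitUniform = 1 := by
  rw [← ofReal_integral_eq_lintegral_ofReal, integral_comp_L fun y => y ^ n / n.factorial]
  · simp only [← mul_div_assoc, integral_div, integral_exp_neg_mul_pow]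
    rw [div_self (by positivity), ENNReal.ofReal_one]
  · rw [integrable_comp_L_iff fun y => y ^ n / n.factorial]
    simp only [← mul_div_assoc]
    exact (integrableOn_exp_neg_mul_pow n).div_const _
  · refine (ae_restrict_mem measurableSet_Ioo).mono fun u hu => ?_
    have := (L_pos hu).le
    simp only [Pi.zero_apply]
    positivity

/-- The `n`-th record value of a standard uniform sample has the density `L(u) ^ n / n!`. -/
theorem map_recordValue [IsProbabilityMeasure P] (hξ : IsUniformSample P ξ) (n : ℕ) :
    P.map (fun ω => recordValue (fun i => ξ i ω) n)
      = unitUniform.withDensity fun u => ENNReal.ofReal (L u ^ n / n.factorial) := by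
  have hX : Measurable fun ω i => ξ i ω := measurable_pi_lambda _ hξ.measurable
  have hR : Measurable fun ω => recordValue (fun i => ξ i ω) n := (measurable_recordValue n).comp hX
  have hprob : (unitUniform.withDensity fun u => ENNReal.ofReal (L u ^ n / n.factorial)) univ
      = 1 := by
    rw [withDensity_apply _ MeasurableSet.univ, Measure.restrict_univ, lintegral_record_density]
  have : IsFiniteMeasure
      (unitUniform.withDensity fun u => ENNReal.ofReal (L u ^ n / n.factorial)) :=
    ⟨by rw [hprob]; exact ENNReal.one_lt_top⟩
  -- The weights give only an inequality of measures, but both sides have mass 1. Equality follows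
  -- without a separate proof that a next record almost surely exists.
  refine (Measure.eq_of_le_of_measure_univ_eq (Measure.le_iff.2 fun s hs => ?_) ?_).symm
  · rw [withDensity_apply _ hs, Measure.map_apply hR hs]
    have hg : Measurable (s.indicator (1 : ℝ → ℝ≥0∞)) := measurable_one.indicator hs
    have h := tsum_lintegral_recordWeight hξ n hg
    calc ∫⁻ u in s, ENNReal.ofReal (L u ^ n / n.factorial) ∂unitUniform
        = ∫⁻ u, s.indicator 1 u * ENNReal.ofReal (L u ^ n / n.factorial) ∂unitUniform := by
          rw [← lintegral_indicator hs]
          refine lintegral_congr fun u => ?_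
          by_cases hu : u ∈ s <;> simp [hu]
      _ = ∫⁻ ω, ∑' m, recordWeight n m (fun i => ξ i ω) * s.indicator 1 (ξ m ω) ∂P := by
          rw [← h]
          exact (lintegral_tsum fun m => (((measurable_recordWeight n m).comp hX).mul
            (hg.comp (hξ.measurable m))).aemeasurable).symm
      _ ≤ ∫⁻ ω, s.indicator 1 (recordValue (fun i => ξ i ω) n) ∂P :=
          lintegral_mono fun ω => tsum_recordWeight_mul_le n (fun i => ξ i ω) (s.indicator 1)
      _ = _ := by
          rw [← lintegral_indicator_one (hR hs)]
          rfl
  · rw [hprob, Measure.map_apply hR MeasurableSet.univ, preimage_univ, measure_univ]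

/-! ### Expected records -/

/-- The `n`-th expected record (numbered from `0`) of a law whose inverse distribution function is
`H ∘ L`. -/
noncomputable def expectedRecord (H : ℝ → ℝ) (n : ℕ) : ℝ :=
  ∫ y in Ioi (0 : ℝ), Real.exp (-y) * y ^ n / n.factorial * H y

theorem IsHStarFun.aestronglyMeasurable {H : ℝ → ℝ} (hH : IsHStarFun H) :
    AEStronglyMeasurable H (volume.restrict (Ioi 0)) :=
  (aemeasurable_restrict_of_monotoneOn measurableSet_Ioi hH.monotone).aestronglyMeasurable

theorem IsHStarFun.integrableOn_mul {H : ℝ → ℝ} (hH : IsHStarFun H) (n : ℕ) :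
    IntegrableOn (fun y => Real.exp (-y) * y ^ n * H y) (Ioi 0) := by
  refine (hH.integrable n).mono' ?_ ?_
  · exact (Continuous.aestronglyMeasurable (by fun_prop)).mul hH.aestronglyMeasurable
  · refine (ae_restrict_mem measurableSet_Ioi).mono fun y hy => le_of_eq ?_
    rw [mem_Ioi] at hy
    rw [norm_mul, norm_mul, Real.norm_eq_abs, Real.norm_eq_abs, Real.norm_eq_abs,
      abs_of_pos (Real.exp_pos _), abs_of_nonneg (by positivity : 0 ≤ y ^ n)]
    ring

theorem IsHStarFun.integrableOn_density_mul {H : ℝ → ℝ} (hH : IsHStarFun H) (n : ℕ) :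
    IntegrableOn (fun y => Real.exp (-y) * y ^ n / n.factorial * H y) (Ioi 0) := by
  refine ((hH.integrableOn_mul n).div_const (n.factorial : ℝ)).congr
    (Filter.Eventually.of_forall fun y => ?_)
  ring

theorem integrable_record_and_integral_record [IsProbabilityMeasure P] (hξ : IsUniformSample P ξ)
    {H : ℝ → ℝ} (hH : IsHStarFun H) {μ : Measure ℝ}
    (hμ : ∀ u ∈ Ioo (0 : ℝ) 1, quantile μ u = H (L u)) (n : ℕ) :
    Integrable (record ξ μ n) P ∧ ∫ ω, record ξ μ n ω ∂P = expectedRecord H n := by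
  have hX : Measurable fun ω i => ξ i ω := measurable_pi_lambda _ hξ.measurable
  have hR : Measurable fun ω => recordValue (fun i => ξ i ω) n := (measurable_recordValue n).comp hX
  have hq : (fun u => quantile μ u) =ᵐ[unitUniform] fun u => H (L u) :=
    (ae_restrict_mem measurableSet_Ioo).mono hμ
  have hmono : MonotoneOn (fun u => H (L u)) (Ioo 0 1) := fun u hu v hv huv =>
    hH.monotone (L_pos hu) (L_pos hv) (L_le_L huv hv.2)
  have hm : AEStronglyMeasurable (quantile μ) unitUniform :=
    (aemeasurable_restrict_of_monotoneOn measurableSet_Ioo hmono).aestronglyMeasurable.congr hq.symm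
  have hm' : AEStronglyMeasurable (quantile μ)
      (P.map fun ω => recordValue (fun i => ξ i ω) n) := by
    rw [map_recordValue hξ]
    exact hm.mono_ac (withDensity_absolutelyContinuous _ _)
  have hdm : Measurable fun u => ENNReal.ofReal (L u ^ n / n.factorial) :=
    ((measurable_L.pow_const n).div_const _).ennreal_ofReal
  have hdens : (fun u => (ENNReal.ofReal (L u ^ n / n.factorial)).toReal • quantile μ u)
      =ᵐ[unitUniform] fun u => (fun y => y ^ n / n.factorial * H y) (L u) := by
    refine (ae_restrict_mem measurableSet_Ioo).mono fun u hu => ?_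
    have := (L_pos hu).le
    simp only [smul_eq_mul]
    rw [ENNReal.toReal_ofReal (by positivity), hμ u hu]
  have hfin : ∀ᵐ u ∂unitUniform, ENNReal.ofReal (L u ^ n / n.factorial) < ∞ :=
    Filter.Eventually.of_forall fun u => ENNReal.ofReal_lt_top
  constructor
  · refine (integrable_map_measure hm' hR.aemeasurable).1 ?_
    rw [map_recordValue hξ, integrable_withDensity_iff_integrable_smul' hdm hfin,
      integrable_congr hdens,
      integrable_comp_L_iff fun y => y ^ n / n.factorial * H y]
    refine (hH.integrableOn_density_mul n).congr (Filter.Eventually.of_forall fun y => ?_)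
    ring
  · have := integral_map hR.aemeasurable hm'
    refine this.symm.trans ?_
    rw [map_recordValue hξ, integral_withDensity_eq_integral_toReal_smul hdm hfin,
      integral_congr_ae hdens, integral_comp_L fun y => y ^ n / n.factorial * H y,
      expectedRecord]
    refine integral_congr_ae (Filter.Eventually.of_forall fun y => ?_)
    ring

/-! ### Differences of expected records -/

/-- The difference of two consecutive gamma densities. -/
noncomputable def gammaDiff (n : ℕ) (y : ℝ) : ℝ :=
  Real.exp (-y) * y ^ (n + 1) / (n + 1).factorial - Real.exp (-y) * y ^ n / n.factorial

theorem continuous_gammaDiff (n : ℕ) : Continuous (gammaDiff n) := by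
  unfold gammaDiff; fun_prop

theorem integrableOn_gammaDiff (n : ℕ) : IntegrableOn (gammaDiff n) (Ioi 0) :=
  ((integrableOn_exp_neg_mul_pow (n + 1)).div_const _).sub
    ((integrableOn_exp_neg_mul_pow n).div_const _)

/-- The kernel is the derivative of -e^{-y} y^{n+1} / (n+1)!. The case `t = 0` says that its total
mass is 0. -/
theorem integral_gammaDiff_Ioi (n : ℕ) {t : ℝ} (ht : 0 ≤ t) :
    ∫ y in Ioi t, gammaDiff n y = Real.exp (-t) * t ^ (n + 1) / (n + 1).factorial := by
  have hder : ∀ y : ℝ, HasDerivAt (fun y => -(Real.exp (-y) * y ^ (n + 1) / (n + 1).factorial))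
      (gammaDiff n y) y := by
    intro y
    have := (((hasDerivAt_neg y).exp.mul (hasDerivAt_pow (n + 1) y)).div_const
      ((n + 1).factorial : ℝ)).neg
    refine this.congr_deriv ?_
    rw [gammaDiff, Nat.factorial_succ]
    push_cast
    have : (n.factorial : ℝ) ≠ 0 := by positivity
    field_simp
    simp
    ring
  have hlim : Filter.Tendsto (fun y : ℝ => -(Real.exp (-y) * y ^ (n + 1) / (n + 1).factorial))
      Filter.atTop (nhds 0) := by
    have := ((Real.tendsto_pow_mul_exp_neg_atTop_nhds_zero (n + 1)).div_const
      ((n + 1).factorial : ℝ)).neg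
    simpa [mul_comm] using this
  rw [integral_Ioi_of_hasDerivAt_of_tendsto (hder t).continuousAt.continuousWithinAt
    (fun y _ => hder y) ((integrableOn_gammaDiff n).mono_set (Ioi_subset_Ioi ht)) hlim]
  ring

theorem IsHStarFun.integrableOn_gammaDiff_mul {H : ℝ → ℝ} (hH : IsHStarFun H) (n : ℕ) :
    IntegrableOn (fun y => gammaDiff n y * H y) (Ioi 0) := by
  refine ((hH.integrableOn_density_mul (n + 1)).sub (hH.integrableOn_density_mul n)).congr
    (Filter.Eventually.of_forall fun y => ?_)
  simp only [gammaDiff, Pi.sub_apply]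
  ring

theorem IsHStarFun.expectedRecord_sub {H : ℝ → ℝ} (hH : IsHStarFun H) (n : ℕ) :
    expectedRecord H (n + 1) - expectedRecord H n = ∫ y in Ioi (0 : ℝ), gammaDiff n y * H y := by
  rw [expectedRecord, expectedRecord, ← integral_sub (hH.integrableOn_density_mul (n + 1))
    (hH.integrableOn_density_mul n)]
  refine integral_congr_ae (Filter.Eventually.of_forall fun y => ?_)
  simp only [gammaDiff]
  ring

/-- If `H` is up to a constant an average of the step functions `χ s - b s`, then its integral
against a kernel of total mass `0` is the average of the integrals of the functions `χ s`. -/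
theorem integral_kernel_mul_eq {S : Type*} [MeasurableSpace S] {ν : Measure S} [SFinite ν]
    {m : Measure ℝ} [SFinite m] {k H : ℝ → ℝ} {w b : S → ℝ} {χ : S → ℝ → ℝ} {c : ℝ}
    (hk : Integrable k m) (hk0 : ∫ y, k y ∂m = 0)
    (hχ : ∀ s, Integrable (fun y => k y * χ s y) m)
    (hH : ∀ᵐ y ∂m, H y = c + ∫ s, w s * (χ s y - b s) ∂ν)
    (hint : Integrable (fun p : S × ℝ => k p.2 * (w p.1 * (χ p.1 p.2 - b p.1))) (ν.prod m)) :
    Integrable (fun s => w s * ∫ y, k y * χ s y ∂m) ν ∧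
      ∫ y, k y * H y ∂m = ∫ s, w s * ∫ y, k y * χ s y ∂m ∂ν := by
  -- The kernel has mass 0, so `b s` drops out; it serves only to make the double integral converge
  -- absolutely.
  have hinner : ∀ s, ∫ y, k y * (w s * (χ s y - b s)) ∂m = w s * ∫ y, k y * χ s y ∂m := by
    intro s
    have h : ∀ y, k y * (w s * (χ s y - b s)) = w s * (k y * χ s y) - k y * (w s * b s) := by
      intro y; ring
    simp only [h]
    rw [integral_sub ((hχ s).const_mul _) (hk.mul_const _), integral_const_mul, integral_mul_const,
      hk0]
    ring
  refine ⟨hint.integral_prod_left.congr (Filter.Eventually.of_forall hinner), ?_⟩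
  calc ∫ y, k y * H y ∂m = ∫ y, (k y * c + ∫ s, k y * (w s * (χ s y - b s)) ∂ν) ∂m := by
        refine integral_congr_ae (hH.mono fun y hy => ?_)
        simp only
        rw [hy, mul_add, integral_const_mul]
    _ = ∫ y, ∫ s, k y * (w s * (χ s y - b s)) ∂ν ∂m := by
        rw [integral_add (hk.mul_const c) hint.integral_prod_right, integral_mul_const, hk0]
        ring
    _ = ∫ s, ∫ y, k y * (w s * (χ s y - b s)) ∂m ∂ν := (integral_integral_swap hint).symm
    _ = _ := by simp only [hinner]

end RecordSeq

namespace RecordSeq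

open scoped ENNReal

/-! ### The mapping `φ` -/

/-- The limits of the distribution function at ±∞ make the defining set nonempty and bounded below;
right continuity puts its infimum into the set. -/
theorem quantile_le_iff (μ : Measure ℝ) {u : ℝ} (hu : u ∈ Ioo (0 : ℝ) 1) (x : ℝ) :
    quantile μ u ≤ x ↔ u ≤ cdf μ x := by
  have hne : {x : ℝ | u ≤ cdf μ x}.Nonempty :=
    ((tendsto_cdf_atTop μ).eventually (eventually_ge_nhds hu.2)).exists
  have hbdd : BddBelow {x : ℝ | u ≤ cdf μ x} := by
    obtain ⟨z, hz⟩ := ((tendsto_cdf_atBot μ).eventually (eventually_lt_nhds hu.1)).exists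
    refine ⟨z, fun x hx => ?_⟩
    by_contra! h
    exact absurd (hx.trans (monotone_cdf μ h.le)) (not_le.2 hz)
  constructor
  · intro h
    have hright : Filter.Tendsto (cdf μ) (nhdsWithin x (Ioi x)) (nhds (cdf μ x)) :=
      ((cdf μ).right_continuous x).mono_left (nhdsWithin_mono _ Ioi_subset_Ici_self)
    refine ge_of_tendsto hright ?_
    filter_upwards [self_mem_nhdsWithin] with z hz
    obtain ⟨a, ha, haz⟩ := (csInf_lt_iff hbdd hne).1 (lt_of_le_of_lt h hz)
    exact le_trans ha (monotone_cdf μ haz.le)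
  · intro h
    exact csInf_le hbdd h

/-- The integral of the difference of the indicators of two half lines. -/
theorem indicator_Iio_sub (p q : ℝ) :
    Integrable (fun x => (Iio p).indicator (1 : ℝ → ℝ) x - (Iio q).indicator 1 x) ∧
    ∫ x, ((Iio p).indicator (1 : ℝ → ℝ) x - (Iio q).indicator 1 x) = p - q ∧
    ∫ x, |(Iio p).indicator (1 : ℝ → ℝ) x - (Iio q).indicator 1 x| = |p - q| := by
  have key : ∀ p q : ℝ, q ≤ p → (fun x => (Iio p).indicator (1 : ℝ → ℝ) x - (Iio q).indicator 1 x)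
      = (Ico q p).indicator 1 := by
    intro p q h
    ext x
    simp only [indicator, mem_Iio, mem_Ico, Pi.one_apply]
    grind
  have hint : ∀ p q : ℝ, q ≤ p → Integrable ((Ico q p).indicator (1 : ℝ → ℝ)) ∧
      ∫ x, (Ico q p).indicator (1 : ℝ → ℝ) x = p - q := by
    intro p q h
    constructor
    · exact (integrable_indicator_iff measurableSet_Ico).2 (integrableOn_const (by simp))
    · rw [integral_indicator_one measurableSet_Ico]
      simp [h]
  have habs : ∀ (p q x : ℝ), |(Ico q p).indicator (1 : ℝ → ℝ) x| = (Ico q p).indicator 1 x := by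
    intro p q x
    exact abs_of_nonneg (indicator_nonneg (by simp) _)
  rcases le_total q p with h | h
  · refine ⟨by rw [key p q h]; exact (hint p q h).1, by rw [key p q h]; exact (hint p q h).2, ?_⟩
    have : ∀ x, |(Iio p).indicator (1 : ℝ → ℝ) x - (Iio q).indicator 1 x|
        = (Ico q p).indicator 1 x := fun x => by rw [← habs, ← key p q h]
    simp only [this]
    rw [(hint p q h).2, abs_of_nonneg (by linarith)]
  · have hneg : (fun x => (Iio p).indicator (1 : ℝ → ℝ) x - (Iio q).indicator 1 x)
        = fun x => -(Ico p q).indicator 1 x := by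
      rw [← key q p h]; ext x; ring
    refine ⟨by rw [hneg]; exact (hint q p h).1.neg, ?_, ?_⟩
    · rw [hneg, integral_neg, (hint q p h).2]; ring
    · have : ∀ x, |(Iio p).indicator (1 : ℝ → ℝ) x - (Iio q).indicator 1 x|
          = (Ico p q).indicator 1 x := fun x => by
        rw [← habs, ← key q p h, abs_sub_comm]
      simp only [this]
      rw [(hint q p h).2, abs_of_nonpos (by linarith)]; ring

section

variable {μ : Measure ℝ} {H : ℝ → ℝ}

/-- This is `quantile_le_iff` negated at u = 1 - e^{-y}, where L(u) = y. It describes the level sets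
of `H` by half-lines in `y`. -/
theorem lt_iff_cdf_lt (hμ : ∀ u ∈ Ioo (0 : ℝ) 1, quantile μ u = H (L u)) {y : ℝ} (hy : 0 < y)
    (x : ℝ) : x < H y ↔ cdf μ x < 1 - Real.exp (-y) := by
  have h := quantile_le_iff μ (one_sub_exp_neg_mem hy) x
  rw [hμ _ (one_sub_exp_neg_mem hy), L_one_sub_exp_neg] at h
  rw [← not_le, ← not_le, h]

theorem setIntegral_gammaDiff_cdf (μ : Measure ℝ) (n : ℕ) (x : ℝ) :
    ∫ y in Ioi (0 : ℝ), gammaDiff n y * {y : ℝ | cdf μ x < 1 - Real.exp (-y)}.indicator 1 y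
      = (1 - cdf μ x) * L (cdf μ x) ^ (n + 1) / (n + 1).factorial := by
  have hms : MeasurableSet {y : ℝ | cdf μ x < 1 - Real.exp (-y)} :=
    measurableSet_lt measurable_const (by fun_prop)
  have : ∀ y, gammaDiff n y * {y : ℝ | cdf μ x < 1 - Real.exp (-y)}.indicator 1 y
      = {y : ℝ | cdf μ x < 1 - Real.exp (-y)}.indicator (gammaDiff n) y := by
    intro y
    by_cases h : y ∈ {y : ℝ | cdf μ x < 1 - Real.exp (-y)}
    · rw [indicator_of_mem h, indicator_of_mem h, Pi.one_apply, mul_one]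
    · rw [indicator_of_notMem h, indicator_of_notMem h, mul_zero]
  simp only [this]
  rw [setIntegral_indicator hms]
  -- If F(x) = 1, the set is empty and the convention `L 1 = 0` does not give its endpoint; the
  -- factor 1 - F(x) makes the right side 0 all the same.
  rcases (cdf_le_one μ x).eq_or_lt with h1 | h1
  · rw [h1, sub_self, zero_mul, zero_div]
    have : Ioi (0 : ℝ) ∩ {y : ℝ | 1 < 1 - Real.exp (-y)} = ∅ := by
      ext y
      simp only [mem_inter_iff, mem_ofPred_eq, mem_empty_iff_false, iff_false, not_and, not_lt]
      intro _
      linarith [Real.exp_pos (-y)]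
    rw [this, setIntegral_empty]
  · have hset : Ioi (0 : ℝ) ∩ {y : ℝ | cdf μ x < 1 - Real.exp (-y)} = Ioi (L (cdf μ x)) := by
      ext y
      have h2 : cdf μ x < 1 - Real.exp (-y) ↔ L (cdf μ x) < y := by
        have : cdf μ x = 1 - Real.exp (-L (cdf μ x)) := by rw [exp_neg_L h1]; ring
        constructor
        · intro h
          rw [this] at h
          have := Real.exp_lt_exp.1 (lt_of_sub_pos (by linarith) :
            Real.exp (-y) < Real.exp (-L (cdf μ x)))
          linarith
        · intro h
          rw [this]
          have := Real.exp_lt_exp.2 (neg_lt_neg h)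
          linarith
      simp only [mem_inter_iff, mem_ofPred_eq, mem_Ioi, h2]
      exact ⟨fun h => h.2, fun h => ⟨(L_nonneg (cdf_nonneg μ x) h1.le).trans_lt h, h⟩⟩
    rw [hset, integral_gammaDiff_Ioi n (L_nonneg (cdf_nonneg μ x) h1.le), exp_neg_L h1]

/-- Layer-cake formula for `H` relative to the level `H 1`, integrated against the kernel. Any other
value of `H` on (0,∞) could serve as reference level. -/
theorem integrable_and_integral_tail (hH : IsHStarFun H)
    (hμ : ∀ u ∈ Ioo (0 : ℝ) 1, quantile μ u = H (L u)) (n : ℕ) :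
    Integrable (fun x => (1 - cdf μ x) * L (cdf μ x) ^ (n + 1)) ∧
    ∫ x, (1 - cdf μ x) * L (cdf μ x) ^ (n + 1)
      = (n + 1).factorial * (expectedRecord H (n + 1) - expectedRecord H n) := by
  -- For y > 0 this is the indicator of x < H(y). Written through the distribution function it is
  -- jointly measurable without any control of `H` outside (0,∞).
  let χ : ℝ → ℝ → ℝ := fun x y => {y : ℝ | cdf μ x < 1 - Real.exp (-y)}.indicator 1 y
  have hχ : ∀ y, 0 < y → ∀ x, χ x y = (Iio (H y)).indicator 1 x := by
    intro y hy x
    simp only [χ, indicator, mem_ofPred_eq, mem_Iio, lt_iff_cdf_lt hμ hy, Pi.one_apply]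
  have hχm : Measurable fun p : ℝ × ℝ => χ p.1 p.2 := by
    have : (fun p : ℝ × ℝ => χ p.1 p.2)
        = {p : ℝ × ℝ | cdf μ p.1 < 1 - Real.exp (-p.2)}.indicator 1 := by
      ext p; simp [χ, indicator]
    rw [this]
    refine measurable_one.indicator (measurableSet_lt ?_ (by fun_prop))
    exact (monotone_cdf μ).measurable.comp measurable_fst
  have hχ1 : ∀ x y, ‖χ x y‖ ≤ 1 := by
    intro x y
    refine (norm_indicator_le_norm_self _ _).trans (by simp)
  have hk := integrableOn_gammaDiff n
  have h1 := hH.integrableOn_gammaDiff_mul n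
  have h := integral_kernel_mul_eq (ν := volume) (m := volume.restrict (Ioi 0))
    (k := gammaDiff n) (H := H) (w := fun _ => 1) (b := (Iio (H 1)).indicator 1) (χ := χ)
    (c := H 1) hk (by rw [integral_gammaDiff_Ioi n le_rfl]; simp)
    (fun x => hk.mul_bdd (c := 1) (hχm.comp measurable_prodMk_left).aestronglyMeasurable
      (Filter.Eventually.of_forall fun y => hχ1 x y)) ?_ ?_
  · have hval : ∀ x, (1 : ℝ) * ∫ y in Ioi (0 : ℝ), gammaDiff n y * χ x y
        = (1 - cdf μ x) * L (cdf μ x) ^ (n + 1) / (n + 1).factorial := fun x => by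
      rw [one_mul]; exact setIntegral_gammaDiff_cdf μ n x
    simp only [hval] at h
    have hfac : ((n + 1).factorial : ℝ) ≠ 0 := by positivity
    constructor
    · refine (h.1.mul_const ((n + 1).factorial : ℝ)).congr (Filter.Eventually.of_forall fun x => ?_)
      simp only
      rw [div_mul_cancel₀ _ hfac]
    · rw [hH.expectedRecord_sub, h.2, integral_div, mul_div_cancel₀ _ hfac]
  · refine (ae_restrict_mem measurableSet_Ioi).mono fun y hy => ?_
    simp only [one_mul, hχ y hy, (indicator_Iio_sub _ _).2.1]
    ring
  · have hm : AEStronglyMeasurable (fun p : ℝ × ℝ => gammaDiff n p.2 *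
        ((1 : ℝ) * (χ p.1 p.2 - (Iio (H 1)).indicator 1 p.1)))
        (volume.prod (volume.restrict (Ioi 0))) := by
      refine Measurable.aestronglyMeasurable ?_
      exact ((continuous_gammaDiff n).measurable.comp measurable_snd).mul (measurable_const.mul
        (hχm.sub ((measurable_one.indicator measurableSet_Iio).comp measurable_fst)))
    refine (integrable_prod_iff' hm).2 ⟨?_, ?_⟩
    · refine (ae_restrict_mem measurableSet_Ioi).mono fun y hy => ?_
      simp only [one_mul, hχ y hy]
      exact (indicator_Iio_sub _ _).1.const_mul _
    -- Integrating the absolute value in x leaves |`gammaDiff n y`| |H(y) - H(1)|, which is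
    -- integrable.
    · refine (h1.sub (hk.mul_const (H 1))).norm.congr ?_
      refine (ae_restrict_mem measurableSet_Ioi).mono fun y hy => ?_
      simp only [one_mul, hχ y hy, norm_mul, integral_const_mul, Real.norm_eq_abs, Pi.sub_apply]
      rw [(indicator_Iio_sub _ _).2.2, ← abs_mul]
      congr 1
      ring

theorem tail_nonneg (μ : Measure ℝ) (x : ℝ) : 0 ≤ (1 - cdf μ x) * L (cdf μ x) :=
  mul_nonneg (by linarith [cdf_le_one μ x]) (L_nonneg (cdf_nonneg μ x) (cdf_le_one μ x))

/-- Being monotone and non-constant, `H` takes two values H(y) < H(z); on the interval [H(y), H(z))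
the distribution function lies strictly between 0 and 1. -/
theorem integral_tail_pos (hH : IsHStarFun H)
    (hμ : ∀ u ∈ Ioo (0 : ℝ) 1, quantile μ u = H (L u)) :
    0 < ∫ x, (1 - cdf μ x) * L (cdf μ x) := by
  have hint := (integrable_and_integral_tail hH hμ 0).1
  simp only [zero_add, pow_one] at hint
  rw [integral_pos_iff_support_of_nonneg (tail_nonneg μ) hint]
  obtain ⟨y, z, hy, hyz, hlt⟩ : ∃ y z : ℝ, 0 < y ∧ y ≤ z ∧ H y < H z := by
    by_contra! hcon
    refine hH.nonconstant ⟨H 1, fun y hy => ?_⟩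
    rcases le_total y 1 with h | h
    · exact le_antisymm (hH.monotone hy (mem_Ioi.2 one_pos) h) (hcon y 1 hy h)
    · exact le_antisymm (hcon 1 y one_pos h) (hH.monotone (mem_Ioi.2 one_pos) hy h)
  refine lt_of_lt_of_le (?_ : 0 < volume (Ico (H y) (H z))) (measure_mono fun x hx => ?_)
  · simp [hlt]
  · have h1 : ¬ cdf μ x < 1 - Real.exp (-y) := fun h =>
      absurd ((lt_iff_cdf_lt hμ hy x).2 h) (not_lt.2 hx.1)
    have h2 := (lt_iff_cdf_lt hμ (hy.trans_le hyz) x).1 hx.2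
    have h3 := (one_sub_exp_neg_mem hy).1
    have h4 := (one_sub_exp_neg_mem (hy.trans_le hyz)).2
    have h5 : cdf μ x ∈ Ioo (0 : ℝ) 1 := ⟨by linarith, by linarith⟩
    exact (mul_pos (by linarith [h5.2]) (L_pos h5)).ne'

theorem densityV_nonneg (hH : IsHStarFun H)
    (hμ : ∀ u ∈ Ioo (0 : ℝ) 1, quantile μ u = H (L u)) (x : ℝ) : 0 ≤ densityV μ x :=
  div_nonneg (tail_nonneg μ x) (integral_tail_pos hH hμ).le

theorem measurable_densityV (μ : Measure ℝ) : Measurable (densityV μ) :=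
  ((measurable_const.sub (monotone_cdf μ).measurable).mul
    (measurable_L.comp (monotone_cdf μ).measurable)).div_const _

theorem measurable_L_cdf (μ : Measure ℝ) : Measurable fun x => L (cdf μ x) :=
  measurable_L.comp (monotone_cdf μ).measurable

/-- The normalising constant of the density is itself the case n = 0 of
`integrable_and_integral_tail`, which explains the denominator. -/
theorem integrable_and_integral_pow_phi (hH : IsHStarFun H)
    (hμ : ∀ u ∈ Ioo (0 : ℝ) 1, quantile μ u = H (L u)) (n : ℕ) :
    Integrable (fun t : ℝ => t ^ n) (phi μ) ∧
    ∫ t, t ^ n ∂(phi μ) = (n + 1).factorial * (expectedRecord H (n + 1) - expectedRecord H n) /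
      (expectedRecord H 1 - expectedRecord H 0) := by
  have hZ : ∫ x, (1 - cdf μ x) * L (cdf μ x) = expectedRecord H 1 - expectedRecord H 0 := by
    simpa using (integrable_and_integral_tail hH hμ 0).2
  have hdm : Measurable fun x => ENNReal.ofReal (densityV μ x) := (measurable_densityV μ).ennreal_ofReal
  have hfin : ∀ᵐ x : ℝ, ENNReal.ofReal (densityV μ x) < ∞ :=
    Filter.Eventually.of_forall fun u => ENNReal.ofReal_lt_top
  have hdens : ∀ x, (ENNReal.ofReal (densityV μ x)).toReal • L (cdf μ x) ^ n
      = (1 - cdf μ x) * L (cdf μ x) ^ (n + 1) / (expectedRecord H 1 - expectedRecord H 0) := by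
    intro x
    rw [ENNReal.toReal_ofReal (densityV_nonneg hH hμ x), densityV, hZ, smul_eq_mul]
    ring
  have hcont : AEStronglyMeasurable (fun t : ℝ => t ^ n) (phi μ) :=
    (continuous_pow n).aestronglyMeasurable
  have htail := integrable_and_integral_tail hH hμ n
  constructor
  · rw [phi, integrable_map_measure hcont (measurable_L_cdf μ).aemeasurable, lawV,
      integrable_withDensity_iff_integrable_smul' hdm hfin]
    simp only [Function.comp_apply, hdens]
    exact htail.1.div_const _
  · rw [phi, integral_map (measurable_L_cdf μ).aemeasurable hcont, lawV,
      integral_withDensity_eq_integral_toReal_smul hdm hfin]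
    simp only [hdens]
    rw [integral_div, htail.2]

theorem memT_phi (hH : IsHStarFun H)
    (hμ : ∀ u ∈ Ioo (0 : ℝ) 1, quantile μ u = H (L u)) : MemT (phi μ) := by
  have hZ := integral_tail_pos hH hμ
  have hint := (integrable_and_integral_tail hH hμ 0).1
  simp only [zero_add, pow_one] at hint
  have hV : IsProbabilityMeasure (lawV μ) := by
    refine ⟨?_⟩
    rw [lawV, withDensity_apply _ MeasurableSet.univ, Measure.restrict_univ,
      ← ofReal_integral_eq_lintegral_ofReal]
    · simp only [densityV]
      rw [integral_div, div_self hZ.ne', ENNReal.ofReal_one]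
    · exact hint.div_const _
    · exact Filter.Eventually.of_forall (densityV_nonneg hH hμ)
  refine ⟨Measure.isProbabilityMeasure_map (measurable_L_cdf μ).aemeasurable, ?_,
    fun n => (integrable_and_integral_pow_phi hH hμ n).1⟩
  rw [phi, ae_map_iff (measurable_L_cdf μ).aemeasurable measurableSet_Ioi, lawV,
    ae_withDensity_iff (measurable_densityV μ).ennreal_ofReal]
  refine Filter.Eventually.of_forall fun x hx => ?_
  -- Where L(F(x)) = 0 the density of V vanishes, so such points carry no mass.
  refine lt_of_le_of_ne (L_nonneg (cdf_nonneg μ x) (cdf_le_one μ x)) fun h0 => hx ?_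
  rw [densityV, ← h0]
  simp

theorem momentRelation_phi (hH : IsHStarFun H)
    (hμ : ∀ u ∈ Ioo (0 : ℝ) 1, quantile μ u = H (L u)) {ρ : ℕ → ℝ}
    (hρ : ∀ n, ρ (n + 1) = expectedRecord H n) : MomentRelation ρ (phi μ) := by
  intro n
  rw [(integrable_and_integral_pow_phi hH hμ n).2, hρ (n + 1), hρ n, hρ 1, hρ 0]
  have hfac : ((n + 1).factorial : ℝ) ≠ 0 := by positivity
  field_simp

end

end RecordSeq

namespace RecordSeq

open scoped ENNReal

/-! ### The mapping `φ'` -/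

/-- An inverse distribution function is determined by monotonicity and left continuity. -/
theorem quantile_map_unitUniform {G : ℝ → ℝ} (hG : MonotoneOn G (Ioo 0 1))
    (hc : ∀ u ∈ Ioo (0 : ℝ) 1, ContinuousWithinAt G (Iic u) u) {u : ℝ} (hu : u ∈ Ioo (0 : ℝ) 1) :
    quantile (unitUniform.map G) u = G u := by
  have hm : AEMeasurable G unitUniform := aemeasurable_restrict_of_monotoneOn measurableSet_Ioo hG
  have := Measure.isProbabilityMeasure_map hm
  have hset : {x : ℝ | u ≤ cdf (unitUniform.map G) x} = Ici (G u) := by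
    ext x
    simp only [mem_ofPred_eq, mem_Ici, cdf_eq_real, measureReal_def,
      Measure.map_apply_of_aemeasurable hm measurableSet_Iic]
    constructor
    · intro h
      by_contra! hx
      -- Left continuity yields some v < u with x < G(v); by monotonicity {G ≤ x} lies in (0,v) and
      -- has mass at most v < u.
      have h1 : ∀ᶠ v in nhdsWithin u (Iic u), x < G v := (hc u hu).eventually_const_lt hx
      have h1' : ∀ᶠ v in nhdsWithin u (Iio u), x < G v :=
        h1.filter_mono (nhdsWithin_mono _ Iio_subset_Iic_self)
      have h2 : ∀ᶠ v in nhdsWithin u (Iio u), v ∈ Ioo 0 u := Ioo_mem_nhdsLT hu.1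
      obtain ⟨v, hv1, hv2⟩ := (h1'.and h2).exists
      have hle : unitUniform (G ⁻¹' Iic x) ≤ ENNReal.ofReal v := by
        have : unitUniform (G ⁻¹' Iic x) ≤ volume (Ioo 0 v) := by
          rw [Measure.restrict_apply' measurableSet_Ioo]
          refine measure_mono fun w hw => ⟨hw.2.1, ?_⟩
          by_contra! hvw
          exact absurd (hv1.trans_le (hG ⟨hv2.1, hv2.2.trans hu.2⟩ hw.2 hvw)) (not_lt.2 hw.1)
        simpa using this
      have := ENNReal.toReal_mono ENNReal.ofReal_ne_top hle
      rw [ENNReal.toReal_ofReal hv2.1.le] at this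
      linarith [hv2.2]
    · intro h
      have hle : ENNReal.ofReal u ≤ unitUniform (G ⁻¹' Iic x) := by
        have : volume (Ioc 0 u) ≤ unitUniform (G ⁻¹' Iic x) := by
          rw [Measure.restrict_apply' measurableSet_Ioo]
          refine measure_mono fun w hw => ?_
          have hw' : w ∈ Ioo (0 : ℝ) 1 := ⟨hw.1, hw.2.trans_lt hu.2⟩
          exact ⟨(hG hw' hu hw.2).trans h, hw'⟩
        simpa using this
      have := ENNReal.toReal_mono (measure_ne_top _ _) hle
      rwa [ENNReal.toReal_ofReal hu.1.le] at this
  rw [quantile, hset, csInf_Ici]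

/-! ### The function `preH` as an average of step functions. -/

/-- The weight `e ^ t / t`. -/
noncomputable def expDiv (t : ℝ) : ℝ := Real.exp t / t

theorem measurable_expDiv : Measurable expDiv := Real.measurable_exp.div measurable_id

theorem expDiv_pos {t : ℝ} (ht : 0 < t) : 0 < expDiv t := div_pos (Real.exp_pos t) ht

theorem hasDerivAt_expDiv {x : ℝ} (hx : 0 < x) :
    HasDerivAt expDiv ((x - 1) / x ^ 2 * Real.exp x) x := by
  refine ((Real.hasDerivAt_exp x).div (hasDerivAt_id x) hx.ne').congr_deriv ?_
  simp only [id]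
  ring

/-- `expDiv (max t x)` is a continuous primitive in `x`, differentiable except possibly at x = t. -/
theorem integral_deriv_expDiv_indicator {t y : ℝ} (ht : 0 < t) (hy : 0 < y) :
    ∫ x in (1 : ℝ)..y, (x - 1) / x ^ 2 * Real.exp x * (Ici t).indicator 1 x
      = expDiv (max t y) - expDiv (max t 1) := by
  have hpos : ∀ x ∈ uIcc 1 y, 0 < x := fun x hx => lt_of_lt_of_le (lt_min one_pos hy) hx.1
  refine integral_eq_of_hasDerivAt_off_countable (fun x => expDiv (max t x)) _
    (countable_singleton t) ?_ ?_ ?_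
  · intro x hx
    have h1 : ContinuousAt expDiv (max t x) :=
      (hasDerivAt_expDiv (lt_max_of_lt_left ht)).continuousAt
    exact (ContinuousAt.comp (f := fun x => max t x) h1 (by fun_prop)).continuousWithinAt
  · rintro x ⟨hx, hxt⟩
    have hx0 : 0 < x := hpos x (Ioo_subset_Icc_self hx)
    rcases lt_or_gt_of_ne hxt with h | h
    · rw [indicator_of_notMem (by simpa using h), mul_zero]
      refine (hasDerivAt_const x (expDiv t)).congr_of_eventuallyEq ?_
      filter_upwards [eventually_lt_nhds h] with z hz
      rw [max_eq_left hz.le]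
    · rw [indicator_of_mem (by exact h.le), Pi.one_apply, mul_one]
      refine (hasDerivAt_expDiv hx0).congr_of_eventuallyEq ?_
      filter_upwards [eventually_gt_nhds h] with z hz
      rw [max_eq_right hz.le]
  · have hc : ContinuousOn (fun x : ℝ => (x - 1) / x ^ 2 * Real.exp x) (uIcc 1 y) := by
      intro x hx
      have := hpos x hx
      refine ContinuousAt.continuousWithinAt ?_
      exact (ContinuousAt.div (by fun_prop) (by fun_prop) (by positivity)).mul (by fun_prop)
    have hi := hc.intervalIntegrable (μ := volume)
    rw [intervalIntegrable_iff] at hi ⊢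
    refine hi.mul_bdd (c := 1) (measurable_one.indicator measurableSet_Ici).aestronglyMeasurable
      (Filter.Eventually.of_forall fun x => ?_)
    exact (norm_indicator_le_norm_self _ _).trans (by simp)

/-- The weighted difference of step functions whose average is `preH`. -/
noncomputable def stepDiff (t y : ℝ) : ℝ :=
  expDiv t * ((Ioi t).indicator 1 y - (Ioi t).indicator 1 1)

/-- Isolates the term that averages to (e^y/y) F_T(y-), the one cancelled by the first summand of
`preH`. -/
theorem expDiv_max_sub (t y : ℝ) :
    expDiv (max t y) - expDiv (max t 1) = expDiv y * (Iio y).indicator 1 t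
      - expDiv 1 * (Iio 1).indicator 1 t - stepDiff t y := by
  have h : ∀ z, expDiv (max t z) = expDiv z * (Iio z).indicator 1 t + expDiv t
      - expDiv t * (Ioi t).indicator 1 z := by
    intro z
    rcases lt_or_ge t z with h | h
    · rw [max_eq_right h.le, indicator_of_mem (by exact h), indicator_of_mem (by exact h)]
      simp
    · rw [max_eq_left h, indicator_of_notMem (by simpa using h),
        indicator_of_notMem (by simpa using h)]
      simp
  rw [h y, h 1, stepDiff]
  ring

theorem measurable_stepDiff : Measurable fun p : ℝ × ℝ => stepDiff p.1 p.2 := by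
  have h : Measurable fun p : ℝ × ℝ => (Ioi p.1).indicator (1 : ℝ → ℝ) p.2 := by
    have : (fun p : ℝ × ℝ => (Ioi p.1).indicator (1 : ℝ → ℝ) p.2)
        = {p : ℝ × ℝ | p.1 < p.2}.indicator 1 := by
      ext p; simp [indicator]
    rw [this]
    exact measurable_one.indicator (measurableSet_lt measurable_fst measurable_snd)
  exact (measurable_expDiv.comp measurable_fst).mul
    (h.sub (h.comp (measurable_fst.prodMk measurable_const)))

section

variable {τ : Measure ℝ}

/-- Write F_T(x) as the τ-mean of 1_{t ≤ x} and apply Fubini; the boundary term at y cancels. The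
weight e^t/t need not be τ-integrable near 0, but `stepDiff t y` vanishes for t below both 1 and y.
-/
theorem integrable_stepDiff_and_preH_eq (hτ : MemT τ) {y : ℝ} (hy : 0 < y) :
    Integrable (fun t => stepDiff t y) τ ∧
      preH τ y = expDiv 1 * τ.real (Iio 1) + ∫ t, stepDiff t y ∂τ := by
  have := hτ.1
  have hpos : ∀ x ∈ uIcc 1 y, 0 < x := fun x hx => lt_of_lt_of_le (lt_min one_pos hy) hx.1
  let f : ℝ → ℝ → ℝ := fun x t => (x - 1) / x ^ 2 * Real.exp x * (Ici t).indicator 1 x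
  have hfm : Measurable (Function.uncurry f) := by
    have : Function.uncurry f = fun p : ℝ × ℝ => (p.1 - 1) / p.1 ^ 2 * Real.exp p.1 *
        {p : ℝ × ℝ | p.2 ≤ p.1}.indicator 1 p := by
      ext p; simp [f, Function.uncurry, indicator]
    rw [this]
    exact Measurable.mul (by fun_prop)
      (measurable_one.indicator (measurableSet_le measurable_snd measurable_fst))
  have hc : ContinuousOn (fun x : ℝ => (x - 1) / x ^ 2 * Real.exp x) (uIcc 1 y) := by
    intro x hx
    have := hpos x hx
    refine ContinuousAt.continuousWithinAt ?_
    exact (ContinuousAt.div (by fun_prop) (by fun_prop) (by positivity)).mul (by fun_prop)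
  have hi := hc.intervalIntegrable (μ := volume)
  rw [intervalIntegrable_iff] at hi
  have hint : Integrable (Function.uncurry f) ((volume.restrict (uIoc 1 y)).prod τ) := by
    refine (Integrable.mul_prod hi (integrable_const (1 : ℝ))).mono hfm.aestronglyMeasurable
      (Filter.Eventually.of_forall fun p => ?_)
    simp only [Function.uncurry, f, norm_mul]
    gcongr
    exact norm_indicator_le_norm_self (f := (1 : ℝ → ℝ)) _
  have hswap := intervalIntegral_integral_swap hint
  have hae : (fun t => ∫ x in (1 : ℝ)..y, f x t) =ᵐ[τ] fun t =>
      expDiv y * (Iio y).indicator 1 t - expDiv 1 * (Iio 1).indicator 1 t - stepDiff t y :=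
    hτ.2.1.mono fun t ht => (integral_deriv_expDiv_indicator ht hy).trans (expDiv_max_sub t y)
  have hintt : Integrable (fun t => ∫ x in (1 : ℝ)..y, f x t) τ := by
    have := hint.integral_prod_right
    rcases le_total 1 y with h | h
    · simp only [intervalIntegral.integral_of_le h]
      rwa [uIoc_of_le h] at this
    · simp only [intervalIntegral.integral_of_ge h]
      rw [uIoc_of_ge h] at this
      exact this.neg
  have hone : ∀ z : ℝ, Integrable ((Iio z).indicator (1 : ℝ → ℝ)) τ := fun z =>
    (integrable_const (1 : ℝ)).indicator measurableSet_Iio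
  have hind : Integrable (fun t => expDiv y * (Iio y).indicator (1 : ℝ → ℝ) t
      - expDiv 1 * (Iio 1).indicator 1 t) τ := ((hone y).const_mul _).sub ((hone 1).const_mul _)
  have hstep : Integrable (fun t => stepDiff t y) τ := by
    refine (hind.sub (hintt.congr hae)).congr (Filter.Eventually.of_forall fun t => ?_)
    simp only [Pi.sub_apply]
    ring
  refine ⟨hstep, ?_⟩
  have hcdf : ∀ x, ∫ t, f x t ∂τ = (x - 1) / x ^ 2 * Real.exp x * cdf τ x := by
    intro x
    simp only [f]
    rw [integral_const_mul, cdf_eq_real, ← integral_indicator_one measurableSet_Iic]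
    rfl
  simp only [hcdf] at hswap
  rw [preH, hswap, integral_congr_ae hae, integral_sub hind hstep,
    integral_sub ((hone y).const_mul _) ((hone 1).const_mul _), integral_const_mul,
    integral_const_mul, integral_indicator_one measurableSet_Iio,
    integral_indicator_one measurableSet_Iio]
  simp only [expDiv]
  ring

theorem stepDiff_mono {t : ℝ} (ht : 0 < t) {y z : ℝ} (hyz : y ≤ z) : stepDiff t y ≤ stepDiff t z := by
  unfold stepDiff
  refine mul_le_mul_of_nonneg_left (sub_le_sub_right ?_ _) (expDiv_pos ht).le
  by_cases h : t < y
  · rw [indicator_of_mem (by exact h), indicator_of_mem (by exact h.trans_le hyz)]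
    simp
  · rw [indicator_of_notMem (by exact h)]
    exact indicator_nonneg (by simp) _

theorem monotoneOn_preH (hτ : MemT τ) : MonotoneOn (preH τ) (Ioi 0) := by
  intro y hy z hz hyz
  rw [(integrable_stepDiff_and_preH_eq hτ hy).2, (integrable_stepDiff_and_preH_eq hτ hz).2]
  refine add_le_add_right ?_ _
  exact integral_mono_ae (integrable_stepDiff_and_preH_eq hτ hy).1
    (integrable_stepDiff_and_preH_eq hτ hz).1 (hτ.2.1.mono fun t ht => stepDiff_mono ht hyz)

/-- Each step 1_{t < y} is left-continuous in y. For z in (y/2, y], monotonicity traps `stepDiff t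
z` between its values at y/2 and y, which yields the dominating function. -/
theorem leftContinuous_preH (hτ : MemT τ) {y : ℝ} (hy : 0 < y) :
    ContinuousWithinAt (preH τ) (Iic y) y := by
  have hy2 : 0 < y / 2 := by positivity
  have hI := fun z (hz : 0 < z) => integrable_stepDiff_and_preH_eq hτ hz
  have hev : ∀ᶠ z in nhdsWithin y (Iic y), z ∈ Ioc (y / 2) y := by
    filter_upwards [self_mem_nhdsWithin,
      nhdsWithin_le_nhds (lt_mem_nhds (by linarith : y / 2 < y))] with z h1 h2
    exact ⟨h2, h1⟩
  have hlim : Filter.Tendsto (fun z => ∫ t, stepDiff t z ∂τ) (nhdsWithin y (Iic y))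
      (nhds (∫ t, stepDiff t y ∂τ)) := by
    refine tendsto_integral_filter_of_dominated_convergence
      (fun t => |stepDiff t (y / 2)| + |stepDiff t y|) ?_ ?_
      ((hI _ hy2).1.abs.add (hI _ hy).1.abs) ?_
    · exact hev.mono fun z hz => (hI z (hy2.trans hz.1)).1.aestronglyMeasurable
    · refine hev.mono fun z hz => hτ.2.1.mono fun t ht => ?_
      have h1 := stepDiff_mono ht hz.1.le
      have h2 := stepDiff_mono ht hz.2
      rw [Real.norm_eq_abs, abs_le]
      constructor
      · linarith [neg_abs_le (stepDiff t (y / 2)), abs_nonneg (stepDiff t y)]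
      · linarith [le_abs_self (stepDiff t y), abs_nonneg (stepDiff t (y / 2))]
    · refine Filter.Eventually.of_forall fun t => ?_
      refine tendsto_const_nhds.congr' ?_
      rcases lt_or_ge t y with h | h
      · filter_upwards [nhdsWithin_le_nhds (lt_mem_nhds h)] with z hz
        rw [stepDiff, stepDiff, indicator_of_mem (a := y) (by exact h),
          indicator_of_mem (a := z) (by exact hz)]
        rfl
      · filter_upwards [self_mem_nhdsWithin] with z hz
        rw [mem_Iic] at hz
        rw [stepDiff, stepDiff, indicator_of_notMem (a := y) (by simpa using h),
          indicator_of_notMem (a := z) (by simpa using hz.trans h)]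
  rw [ContinuousWithinAt, (hI y hy).2]
  refine (hlim.const_add (expDiv 1 * τ.real (Iio 1))).congr' ?_
  exact hev.mono fun z hz => ((hI z (hy2.trans hz.1)).2).symm

/-! ### Integrability against gamma densities and the moments of T. -/

theorem integral_exp_neg_mul_pow_Ioi (n : ℕ) {t : ℝ} (ht : 0 ≤ t) :
    ∫ y in Ioi t, Real.exp (-y) * y ^ n / n.factorial
      = ∑ j ∈ Finset.range (n + 1), Real.exp (-t) * t ^ j / j.factorial := by
  have hint : ∀ m : ℕ, IntegrableOn (fun y : ℝ => Real.exp (-y) * y ^ m / m.factorial) (Ioi t) :=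
    fun m => ((integrableOn_exp_neg_mul_pow m).mono_set (Ioi_subset_Ioi ht)).div_const _
  induction n with
  | zero =>
    simp only [pow_zero, mul_one, Nat.factorial_zero, Nat.cast_one, div_one, zero_add,
      Finset.sum_range_one, integral_exp_neg_Ioi]
  | succ n ih =>
    have h := integral_gammaDiff_Ioi n ht
    simp only [gammaDiff] at h
    rw [integral_sub (hint (n + 1)) (hint n)] at h
    rw [Finset.sum_range_succ, ← ih]
    linarith

/-- For t < 1 the step difference lives on (0,t] with size e^t/t, so the length t cancels the
singularity and leaves at most e. For t ≥ 1 it lives on (t,∞), where the gamma tail e^{-t} Σ t^j/j!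
cancels e^t. The bound is polynomial in t, hence τ-integrable by the moment assumption. -/
theorem integral_abs_stepDiff_le (n : ℕ) {t : ℝ} (ht : 0 < t) :
    ∫ y in Ioi (0 : ℝ), ‖Real.exp (-y) * y ^ n / n.factorial * stepDiff t y‖
      ≤ Real.exp 1 + ∑ j ∈ Finset.range (n + 1), t ^ j / j.factorial := by
  have hint := (integrableOn_exp_neg_mul_pow n).div_const (n.factorial : ℝ)
  have hsum : 0 ≤ ∑ j ∈ Finset.range (n + 1), t ^ j / j.factorial :=
    Finset.sum_nonneg fun j _ => by positivity
  rcases lt_or_ge t 1 with h1 | h1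
  · have heq : ∀ y, 0 < y → ‖Real.exp (-y) * y ^ n / n.factorial * stepDiff t y‖
        ≤ (Ioc 0 t).indicator (fun _ => expDiv t) y := by
      intro y hy
      rw [stepDiff, indicator_of_mem (a := (1 : ℝ)) (by exact h1)]
      by_cases hyt : t < y
      · rw [indicator_of_mem (by exact hyt), indicator_of_notMem (by simp [hyt])]
        simp
      · rw [indicator_of_notMem (by exact hyt), indicator_of_mem (by exact ⟨hy, not_lt.1 hyt⟩)]
        have hle : Real.exp (-y) * y ^ n / n.factorial ≤ 1 := by
          have hyn : y ^ n ≤ 1 := pow_le_one₀ hy.le (by linarith)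
          have he : Real.exp (-y) ≤ 1 := by simpa using hy.le
          have hf : (1 : ℝ) ≤ n.factorial := by exact_mod_cast n.factorial_pos
          rw [div_le_one (by positivity)]
          calc Real.exp (-y) * y ^ n ≤ 1 * 1 := by gcongr
            _ ≤ _ := by linarith
        have h0 : 0 ≤ Real.exp (-y) * y ^ n / n.factorial := by positivity
        simp only [Pi.one_apply, zero_sub, mul_neg, mul_one, norm_neg, norm_mul, Real.norm_eq_abs,
          abs_of_pos (expDiv_pos ht), abs_of_nonneg h0]
        exact mul_le_of_le_one_left (expDiv_pos ht).le hle
    calc ∫ y in Ioi (0 : ℝ), ‖Real.exp (-y) * y ^ n / n.factorial * stepDiff t y‖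
        ≤ ∫ y in Ioi (0 : ℝ), (Ioc 0 t).indicator (fun _ => expDiv t) y := by
          refine integral_mono_of_nonneg (Filter.Eventually.of_forall fun y => norm_nonneg _) ?_
            ((ae_restrict_mem measurableSet_Ioi).mono fun y hy => heq y hy)
          refine Integrable.integrableOn ?_
          exact (integrable_indicator_iff measurableSet_Ioc).2 (integrableOn_const (by simp))
      _ = Real.exp t := by
          rw [setIntegral_indicator measurableSet_Ioc,
            inter_eq_self_of_subset_right Ioc_subset_Ioi_self, setIntegral_const]
          simp only [expDiv, measureReal_def, Real.volume_Ioc, sub_zero, smul_eq_mul]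
          rw [ENNReal.toReal_ofReal ht.le]
          field_simp
      _ ≤ _ := by
          have := Real.exp_le_exp.2 h1.le
          linarith
  · have heq : ∀ y ∈ Ioi (0 : ℝ), ‖Real.exp (-y) * y ^ n / n.factorial * stepDiff t y‖
        = (Ioi t).indicator (fun y => expDiv t * (Real.exp (-y) * y ^ n / n.factorial)) y := by
      intro y hy
      rw [mem_Ioi] at hy
      rw [stepDiff, indicator_of_notMem (a := (1 : ℝ)) (by simpa using h1)]
      by_cases hyt : t < y
      · have h0 : 0 ≤ Real.exp (-y) * y ^ n / n.factorial := by positivity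
        rw [indicator_of_mem (by exact hyt), indicator_of_mem (by exact hyt), Pi.one_apply, sub_zero,
          mul_one, norm_mul, Real.norm_eq_abs, Real.norm_eq_abs, abs_of_pos (expDiv_pos ht),
          abs_of_nonneg h0, mul_comm]
      · rw [indicator_of_notMem (by exact hyt), indicator_of_notMem (by exact hyt)]
        simp
    rw [setIntegral_congr_fun measurableSet_Ioi heq, setIntegral_indicator measurableSet_Ioi,
      inter_eq_self_of_subset_right (Ioi_subset_Ioi ht.le), integral_const_mul,
      integral_exp_neg_mul_pow_Ioi n ht.le, Finset.mul_sum]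
    have : ∑ j ∈ Finset.range (n + 1), expDiv t * (Real.exp (-t) * t ^ j / j.factorial)
        ≤ ∑ j ∈ Finset.range (n + 1), t ^ j / j.factorial := by
      refine Finset.sum_le_sum fun j _ => ?_
      have h0 : expDiv t * Real.exp (-t) ≤ 1 := by
        rw [expDiv, div_mul_eq_mul_div, ← Real.exp_add, add_neg_cancel, Real.exp_zero,
          div_le_one ht]
        exact h1
      calc expDiv t * (Real.exp (-t) * t ^ j / j.factorial)
          = expDiv t * Real.exp (-t) * (t ^ j / j.factorial) := by ring
        _ ≤ 1 * (t ^ j / j.factorial) := by gcongr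
        _ = _ := one_mul _
    linarith [Real.exp_pos 1]

theorem integrable_density_mul_stepDiff (hτ : MemT τ) (n : ℕ) :
    Integrable (fun p : ℝ × ℝ => Real.exp (-p.2) * p.2 ^ n / n.factorial * stepDiff p.1 p.2)
      (τ.prod (volume.restrict (Ioi 0))) := by
  have := hτ.1
  have hm : Measurable fun p : ℝ × ℝ =>
      Real.exp (-p.2) * p.2 ^ n / n.factorial * stepDiff p.1 p.2 :=
    Measurable.mul (by fun_prop) measurable_stepDiff
  refine (integrable_prod_iff hm.aestronglyMeasurable).2 ⟨?_, ?_⟩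
  · refine Filter.Eventually.of_forall fun t => ?_
    refine ((integrableOn_exp_neg_mul_pow n).div_const (n.factorial : ℝ)).mul_bdd
      (c := |expDiv t| * 2) (measurable_stepDiff.comp measurable_prodMk_left).aestronglyMeasurable
      (Filter.Eventually.of_forall fun y => ?_)
    simp only [stepDiff]
    rw [norm_mul, Real.norm_eq_abs]
    gcongr
    refine (norm_sub_le _ _).trans ?_
    have h : ∀ z, ‖(Ioi t).indicator (1 : ℝ → ℝ) z‖ ≤ 1 := fun z =>
      (norm_indicator_le_norm_self _ _).trans (by simp)
    linarith [h y, h 1]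
  · have hb : Integrable (fun t : ℝ => Real.exp 1 +
        ∑ j ∈ Finset.range (n + 1), t ^ j / j.factorial) τ :=
      (integrable_const _).add (integrable_finsetSum _ fun j _ => (hτ.2.2 j).div_const _)
    refine hb.mono' hm.aestronglyMeasurable.norm.integral_prod_right' (hτ.2.1.mono fun t ht => ?_)
    rw [Real.norm_of_nonneg (integral_nonneg fun y => norm_nonneg _)]
    exact integral_abs_stepDiff_le n ht

theorem integrableOn_density_mul_HZero (hτ : MemT τ) (n : ℕ) :
    IntegrableOn (fun y => Real.exp (-y) * y ^ n / n.factorial * HZero τ y) (Ioi 0) := by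
  have := hτ.1
  have h1 := (integrable_density_mul_stepDiff hτ n).integral_prod_right
  have h2 := ((integrableOn_exp_neg_mul_pow n).div_const (n.factorial : ℝ)).mul_const
    (expDiv 1 * τ.real (Iio 1) - cT τ)
  refine (h2.add h1).congr ((ae_restrict_mem measurableSet_Ioi).mono fun y hy => ?_)
  simp only [Pi.add_apply]
  rw [HZero, (integrable_stepDiff_and_preH_eq hτ hy).2, integral_const_mul]
  ring

/-- The step at t contributes (e^t/t) e^{-t} t^{n+1} / (n+1)! = t^n / (n+1)!, and averaging over τ
gives the moment. -/
theorem integral_gammaDiff_mul_HZero (hτ : MemT τ) (n : ℕ) :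
    ∫ y in Ioi (0 : ℝ), gammaDiff n y * HZero τ y = (∫ t, t ^ n ∂τ) / (n + 1).factorial := by
  have := hτ.1
  have hk := integrableOn_gammaDiff n
  have h := (integral_kernel_mul_eq (ν := τ) (m := volume.restrict (Ioi 0)) (k := gammaDiff n)
    (H := HZero τ) (w := expDiv) (b := fun t => (Ioi t).indicator 1 1)
    (χ := fun t => (Ioi t).indicator 1) (c := expDiv 1 * τ.real (Iio 1) - cT τ) hk
    (by rw [integral_gammaDiff_Ioi n le_rfl]; simp)
    (fun t => hk.mul_bdd (c := 1) (measurable_one.indicator measurableSet_Ioi).aestronglyMeasurable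
      (Filter.Eventually.of_forall fun y => (norm_indicator_le_norm_self _ _).trans (by simp)))
    ?_ ?_).2
  · rw [h, ← integral_div]
    refine integral_congr_ae (hτ.2.1.mono fun t ht => ?_)
    have hind : ∀ y, gammaDiff n y * (Ioi t).indicator 1 y = (Ioi t).indicator (gammaDiff n) y := by
      intro y
      by_cases hy : y ∈ Ioi t
      · rw [indicator_of_mem hy, indicator_of_mem hy, Pi.one_apply, mul_one]
      · rw [indicator_of_notMem hy, indicator_of_notMem hy, mul_zero]
    simp only [hind]
    rw [setIntegral_indicator measurableSet_Ioi,
      inter_eq_self_of_subset_right (Ioi_subset_Ioi ht.le), integral_gammaDiff_Ioi n ht.le, expDiv,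
      Real.exp_neg]
    have := Real.exp_pos t
    field_simp
    ring
  · refine (ae_restrict_mem measurableSet_Ioi).mono fun y hy => ?_
    rw [HZero, (integrable_stepDiff_and_preH_eq hτ hy).2]
    simp only [stepDiff]
    ring
  · refine ((integrable_density_mul_stepDiff hτ (n + 1)).sub
      (integrable_density_mul_stepDiff hτ n)).congr (Filter.Eventually.of_forall fun p => ?_)
    simp only [Pi.sub_apply, gammaDiff, stepDiff]
    ring

theorem isHZeroFun_HZero (hτ : MemT τ) : IsHZeroFun (HZero τ) := by
  have hint := integrableOn_density_mul_HZero hτ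
  have hint0 : IntegrableOn (fun y => Real.exp (-y) * HZero τ y) (Ioi 0) := by
    simpa using hint 0
  have hint1 : IntegrableOn (fun y => y * Real.exp (-y) * HZero τ y) (Ioi 0) := by
    simpa [mul_comm] using hint 1
  have hexp : IntegrableOn (fun y : ℝ => Real.exp (-y)) (Ioi 0) := by
    simpa using integrableOn_exp_neg_mul_pow 0
  have hdiff := integral_gammaDiff_mul_HZero hτ 0
  have hτ1 := hτ.1
  simp only [pow_zero, integral_const, probReal_univ, zero_add, Nat.factorial_one, Nat.cast_one,
    div_one, smul_eq_mul, mul_one] at hdiff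
  have hzero : ∫ y in Ioi (0 : ℝ), Real.exp (-y) * HZero τ y = 0 := by
    have hpre : ∀ y, Real.exp (-y) * HZero τ y
        = Real.exp (-y) * preH τ y - Real.exp (-y) * cT τ := fun y => by rw [HZero]; ring
    have hintp : IntegrableOn (fun y => Real.exp (-y) * preH τ y) (Ioi 0) := by
      refine (hint0.add (hexp.mul_const (cT τ))).congr (Filter.Eventually.of_forall fun y => ?_)
      simp only [Pi.add_apply, hpre]
      ring
    simp only [hpre]
    rw [integral_sub hintp (hexp.mul_const _), integral_mul_const, integral_exp_neg_Ioi, cT]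
    simp
  refine ⟨⟨?_, ?_, ?_, ?_⟩, hzero, ?_⟩
  -- A constant would integrate to 0 against the mass-zero kernel, whereas `hdiff` gives 1.
  · rintro ⟨c, hc⟩
    rw [setIntegral_congr_fun (g := fun y => gammaDiff 0 y * c) measurableSet_Ioi
      (fun y hy => by simp only [hc y hy]), integral_mul_const,
      integral_gammaDiff_Ioi 0 le_rfl] at hdiff
    simp at hdiff
  · intro y hy z hz hyz
    exact sub_le_sub_right (monotoneOn_preH hτ hy hz hyz) _
  · intro y hy
    exact (leftContinuous_preH hτ hy).sub continuousWithinAt_const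
  · intro m
    refine ((hint m).norm.mul_const (m.factorial : ℝ)).congr
      ((ae_restrict_mem measurableSet_Ioi).mono fun y hy => ?_)
    rw [mem_Ioi] at hy
    have h0 : 0 ≤ Real.exp (-y) * y ^ m / m.factorial := by positivity
    simp only
    rw [norm_mul, Real.norm_of_nonneg h0, Real.norm_eq_abs]
    field_simp
  -- Since y e^{-y} is `gammaDiff 0 y` plus e^{-y}, the integral is 1 + 0.
  · have : ∀ y, y * Real.exp (-y) * HZero τ y
        = gammaDiff 0 y * HZero τ y + Real.exp (-y) * HZero τ y := by
      intro y
      simp [gammaDiff]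
      ring
    simp only [this]
    rw [integral_add _ hint0, hdiff, hzero, add_zero]
    refine (hint1.sub hint0).congr (Filter.Eventually.of_forall fun y => ?_)
    simp only [Pi.sub_apply, this]
    ring

theorem quantile_phi' (hτ : MemT τ) {u : ℝ} (hu : u ∈ Ioo (0 : ℝ) 1) :
    quantile (phi' τ) u = GZero τ u := by
  have hH := isHZeroFun_HZero hτ
  refine quantile_map_unitUniform (fun u hu v hv huv =>
    hH.monotone (L_pos hu) (L_pos hv) (L_le_L huv hv.2)) (fun u hu => ?_) hu
  have hL : ContinuousAt L u := (hasDerivAt_L hu.2).continuousAt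
  exact (hH.leftContinuous (L u) (L_pos hu)).comp hL.continuousWithinAt
    fun v hv => L_le_L hv hu.2

theorem memHZero_phi' (hτ : MemT τ) : MemHZero (phi' τ) := by
  have hH := isHZeroFun_HZero hτ
  refine ⟨Measure.isProbabilityMeasure_map (μ := unitUniform)
    (aemeasurable_restrict_of_monotoneOn measurableSet_Ioo fun u hu v hv huv =>
      hH.monotone (L_pos hu) (L_pos hv) (L_le_L huv hv.2)),
    HZero τ, hH, fun u hu => quantile_phi' hτ hu⟩

end

end RecordSeq

namespace RecordSeq

/-! ### Expected record sequences and the moment relation. -/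

variable {Ω : Type*} [MeasurableSpace Ω] {P : Measure Ω} {ξ : ℕ → Ω → ℝ}

theorem isExpectedRecordSequence_iff [IsProbabilityMeasure P] (hξ : IsUniformSample P ξ)
    {H : ℝ → ℝ} (hH : IsHStarFun H) {μ : Measure ℝ}
    (hμ : ∀ u ∈ Ioo (0 : ℝ) 1, quantile μ u = H (L u)) {ρ : ℕ → ℝ} :
    IsExpectedRecordSequence P ξ μ ρ ↔ ∀ n, ρ (n + 1) = expectedRecord H n := by
  have h := integrable_record_and_integral_record hξ hH hμ
  exact ⟨fun hρ n => (hρ n).2.trans (h n).2, fun hρ n => ⟨(h n).1, (hρ n).trans (h n).2.symm⟩⟩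

theorem IsHZeroFun.expectedRecord_zero {H : ℝ → ℝ} (hH : IsHZeroFun H) :
    expectedRecord H 0 = 0 := by
  simpa [expectedRecord] using hH.integral_zero

theorem IsHZeroFun.expectedRecord_one {H : ℝ → ℝ} (hH : IsHZeroFun H) :
    expectedRecord H 1 = 1 := by
  simpa [expectedRecord, mul_comm] using hH.integral_one

theorem momentRelation_of_memT {τ : Measure ℝ} (hτ : MemT τ) {ρ : ℕ → ℝ}
    (hρ : ∀ n, ρ (n + 1) = expectedRecord (HZero τ) n) : MomentRelation ρ τ := by
  have hH := isHZeroFun_HZero hτ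
  intro n
  rw [hρ (n + 1), hρ n, hρ 1, hρ 0, hH.expectedRecord_zero, hH.expectedRecord_one,
    hH.toIsHStarFun.expectedRecord_sub, integral_gammaDiff_mul_HZero hτ, sub_zero, div_one]

end RecordSeq

theorem mainTheorem2 {Ω : Type*} [MeasurableSpace Ω] (P : MeasureTheory.Measure Ω)
    [MeasureTheory.IsProbabilityMeasure P] (ξ : ℕ → Ω → ℝ)
    (hξ : RecordSeq.IsUniformSample P ξ) :
    (∀ μ : MeasureTheory.Measure ℝ, RecordSeq.MemHStar μ →
      RecordSeq.MemT (RecordSeq.phi μ) ∧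
      (∃ ρ : ℕ → ℝ, RecordSeq.IsExpectedRecordSequence P ξ μ ρ) ∧
      ∀ ρ : ℕ → ℝ, RecordSeq.IsExpectedRecordSequence P ξ μ ρ →
        RecordSeq.MomentRelation ρ (RecordSeq.phi μ)) ∧
    (∀ τ : MeasureTheory.Measure ℝ, RecordSeq.MemT τ →
      RecordSeq.MemHZero (RecordSeq.phi' τ) ∧
      (∀ u ∈ Set.Ioo (0 : ℝ) 1,
        RecordSeq.quantile (RecordSeq.phi' τ) u = RecordSeq.GZero τ u) ∧
      ∃ ρ : ℕ → ℝ, RecordSeq.IsExpectedRecordSequence P ξ (RecordSeq.phi' τ) ρ ∧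
        ρ 1 = 0 ∧ ρ 2 = 1 ∧ RecordSeq.MomentRelation ρ τ) := by
  refine ⟨fun μ hμ => ?_, fun τ hτ => ?_⟩
  · obtain ⟨-, H, hH, hq⟩ := hμ
    have hiff := fun ρ : ℕ → ℝ => RecordSeq.isExpectedRecordSequence_iff hξ hH hq (ρ := ρ)
    exact ⟨RecordSeq.memT_phi hH hq,
      -- The shift reconciles ρ, indexed from 1, with `expectedRecord`, indexed from 0; the junk
      -- value at n = 0 is never used.
      ⟨fun n => RecordSeq.expectedRecord H (n - 1), (hiff _).2 fun n => rfl⟩,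
      fun ρ hρ => RecordSeq.momentRelation_phi hH hq ((hiff ρ).1 hρ)⟩
  · have hH := RecordSeq.isHZeroFun_HZero hτ
    have hq := fun u (hu : u ∈ Set.Ioo (0 : ℝ) 1) => RecordSeq.quantile_phi' hτ hu
    refine ⟨RecordSeq.memHZero_phi' hτ, hq, fun n => RecordSeq.expectedRecord (RecordSeq.HZero τ) (n - 1),
      (RecordSeq.isExpectedRecordSequence_iff hξ hH.toIsHStarFun hq).2 fun n => rfl,
      hH.expectedRecord_zero, hH.expectedRecord_one,
      RecordSeq.momentRelation_of_memT hτ fun n => rfl⟩
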